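/- Let $N=(G,S,T,c)$ be a network: $G=(V,E)$ is a finite directed graph without loops and multiple edges, $S,T\subseteq V$ are disjoint sets of sources and sinks, $c:E\to\mathbb R_+$ gives the capacities, no edge enters a source and no edge leaves a sink. A vertex is internal if it lies in $V\setminus(S\cup T)$; each internal vertex $v$ has a strict linear order $<^-_v$ on the set $\delta^{in}(v)$ of edges entering $v$ and a strict linear order $<^+_v$ on the set $\delta^{out}(v)$ of edges leaving $v$. For $f:E\to\mathbb R$ put $\mathrm{ex}_f(v)=\sum_{e\in\delta^{in}(v)}f(e)-\sum_{e\in\delta^{out}(v)}f(e)$. Let $\beta,\gamma\in\mathbb R_+^{V\setminus(S\cup T)}$. A $(\beta,\gamma)$-quasi-flow is a function $f:E\to\mathbb R_+$ with $f\le c$ and $-\beta(v)\le \mathrm{ex}_f(v)\le\gamma(v)$ for every internal vertex $v$. It is stable if every directed path $P=(v_0,e_1,v_1,\dots,e_k,v_k)$ with $k\ge1$ (vertices may repeat, and $v_0=v_k$ is allowed) that is unsaturated, i.e. $f(e_i)<c(e_i)$ for all $i$, satisfies at least one of: (a) $v_0$ is internal, $f(e)=0$ for every $e\in\delta^{out}(v_0)$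 with $e_1<^+_{v_0}e$, and $\mathrm{ex}_f(v_0)\le 0$; (b) $v_k$ is internal, $f(e)=0$ for every $e\in\delta^{in}(v_k)$ with $e_k<^-_{v_k}e$, and $\mathrm{ex}_f(v_k)\ge 0$. Proposition. For every network $N$ and all $\beta,\gamma\in\mathbb R_+^{V\setminus(S\cup T)}$ a stable $(\beta,\gamma)$-quasi-flow exists, and it can be found in time $O(nm)$, where $n=|V|$ and $m=|E|$: there are one program and one constant $C$ such that, for every network and all $\beta,\gamma$, the program, given the numbers $n,m$, the kind of each vertex, the two ends and the capacity of each edge, the values of $\beta,\gamma$, and for each vertex its entering and its leaving edges as doubly linked lists (in the order of preference if the vertex is internal, in any order if it is a terminal), halts after at most $C(nm+1)$ elementary steps with a stable $(\beta,\gamma)$-quasi-flow in memory. The machine is a random access machine with cells for natural numbers and for real numbers, whose elementary operations are reading, writing, addition, subtraction, comparison and Boolean connectives. -/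

import Mathlib

open scoped NNReal

universe u

namespace StableFlow

/-! ### Networks -/

/-- The edges of a directed graph, as ordered pairs of vertices (so there are no multiple edges). -/
abbrev Edge {V : Type u} (G : Digraph V) : Type u := {p : V × V // G.Adj p.1 p.2}

/-- The vertex that the edge leaves. -/
def Edge.tail {V : Type u} {G : Digraph V} (e : Edge G) : V := e.1.1

/-- The vertex that the edge enters. -/
def Edge.head {V : Type u} {G : Digraph V} (e : Edge G) : V := e.1.2

/-- The set of edges entering `v`. -/
def edgesIn {V : Type u} (G : Digraph V) (v : V) : Set (Edge G) := {e | e.head = v}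

/-- The set of edges leaving `v`. -/
def edgesOut {V : Type u} (G : Digraph V) (v : V) : Set (Edge G) := {e | e.tail = v}

/-- A network `(G, S, T, c)` with preferences. Only the values of `ltIn v`, `ltOut v` for
nonterminal `v`, on the edges entering (leaving) `v`, matter; `ltIn v e e'` says that `v` prefers
the entering edge `e` to the entering edge `e'`. -/
structure Network (V : Type u) where
  /-- the directed graph -/
  G : Digraph V
  loopless : ∀ v, ¬ G.Adj v v
  /-- the sources -/
  S : Set V
  /-- the sinks -/
  T : Set V
  disjoint_S_T : Disjoint S T
  no_edge_into_source : ∀ s ∈ S, edgesIn G s = ∅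
  no_edge_from_sink : ∀ t ∈ T, edgesOut G t = ∅
  /-- the capacities -/
  c : Edge G → ℝ≥0
  /-- the preferences on entering edges -/
  ltIn : V → Edge G → Edge G → Prop
  /-- the preferences on leaving edges -/
  ltOut : V → Edge G → Edge G → Prop
  ltIn_order : ∀ v, v ∉ S → v ∉ T →
    IsStrictTotalOrder (edgesIn G v) (fun e e' => ltIn v e e')
  ltOut_order : ∀ v, v ∉ S → v ∉ T →
    IsStrictTotalOrder (edgesOut G v) (fun e e' => ltOut v e e')

namespace Network

variable {V : Type u} (N : Network V)

/-- `v` is internal, that is, not a terminal. -/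
def IsInternal (v : V) : Prop := v ∉ N.S ∧ v ∉ N.T

/-- The type of internal vertices. -/
abbrev Internal : Type u := {v : V // N.IsInternal v}

/-- The excess of `f` at `v`: total flow on entering edges minus total flow on leaving edges
(used for finite `V`, where both sums are finite). -/
noncomputable def excess (f : Edge N.G → ℝ) (v : V) : ℝ :=
  (∑ᶠ e ∈ edgesIn N.G v, f e) - ∑ᶠ e ∈ edgesOut N.G v, f e

/-- Nonnegative and bounded by the capacities. -/
def IsAdmissible (f : Edge N.G → ℝ) : Prop := ∀ e, 0 ≤ f e ∧ f e ≤ N.c e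

/-- `(β, γ)`-quasi-flows. -/
def IsQuasiFlow (β γ : N.Internal → ℝ≥0) (f : Edge N.G → ℝ) : Prop :=
  N.IsAdmissible f ∧ ∀ v : N.Internal, -(β v : ℝ) ≤ N.excess f v ∧ N.excess f v ≤ γ v

/-- The edge sequence `P` is that of a directed path (not necessarily simple, possibly closed). -/
def IsDirectedPath (P : List (Edge N.G)) : Prop := P.IsChain (fun e e' => e.head = e'.tail)

/-- Every edge of `P` is unsaturated. -/
def IsUnsaturated (f : Edge N.G → ℝ) (P : List (Edge N.G)) : Prop := ∀ e ∈ P, f e < N.c e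

/-- A path with first edge `e₁` is strongly dominated at its initial vertex `u`: the vertex `u` is
internal, every edge leaving `u` later than `e₁` is free, and the excess at `u` is nonpositive. -/
def StronglyDominatedAtStart (f : Edge N.G → ℝ) (e₁ : Edge N.G) : Prop :=
  N.IsInternal e₁.tail ∧
  (∀ e ∈ edgesOut N.G e₁.tail, N.ltOut e₁.tail e₁ e → f e = 0) ∧
  N.excess f e₁.tail ≤ 0

/-- A path with last edge `eₖ` is strongly dominated at its final vertex `v`: the vertex `v` is
internal, every edge entering `v` later than `eₖ` is free, and the excess at `v` is nonnegative. -/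
def StronglyDominatedAtEnd (f : Edge N.G → ℝ) (eₖ : Edge N.G) : Prop :=
  N.IsInternal eₖ.head ∧
  (∀ e ∈ edgesIn N.G eₖ.head, N.ltIn eₖ.head eₖ e → f e = 0) ∧
  0 ≤ N.excess f eₖ.head

/-- Stable `(β, γ)`-quasi-flows: every unsaturated directed path with at least one edge is strongly
dominated at its initial or at its final vertex. -/
def IsStableQuasiFlow (β γ : N.Internal → ℝ≥0) (f : Edge N.G → ℝ) : Prop :=
  N.IsQuasiFlow β γ f ∧
  ∀ (P : List (Edge N.G)) (hP : P ≠ []), N.IsDirectedPath P → N.IsUnsaturated f P →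
    N.StronglyDominatedAtStart f (P.head hP) ∨ N.StronglyDominatedAtEnd f (P.getLast hP)

end Network

/-! ### A machine model: structured programs for a real random access machine

Memory consists of natural-number variables, real variables, and arrays (indexed by `ℕ`) of natural
numbers and of reals; variables and arrays are named by natural numbers. Elementary operations, each
of cost one, are reading a constant, a variable or an array cell, addition, subtraction, comparison,
a Boolean connective, and writing. There are no real constants but `0`, no multiplication, and no
conversion between natural numbers and reals. -/

/-- The memory contents. -/
structure State where
  /-- natural-number variables -/
  natVar : ℕ → ℕ
  /-- real variables -/
  realVar : ℕ → ℝ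
  /-- arrays of natural numbers -/
  natArr : ℕ → ℕ → ℕ
  /-- arrays of reals -/
  realArr : ℕ → ℕ → ℝ

/-- Natural-number expressions; `sub` is truncated subtraction. -/
inductive NatExp where
  | const (k : ℕ)
  | var (x : ℕ)
  | arr (a : ℕ) (i : NatExp)
  | add (p q : NatExp)
  | sub (p q : NatExp)

/-- Real expressions. -/
inductive RealExp where
  | zero
  | var (x : ℕ)
  | arr (a : ℕ) (i : NatExp)
  | add (p q : RealExp)
  | sub (p q : RealExp)

/-- Tests. -/
inductive Test where
  | natEq (p q : NatExp)
  | natLt (p q : NatExp)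
  | realEq (p q : RealExp)
  | realLt (p q : RealExp)
  | not (b : Test)
  | and (b d : Test)
  | or (b d : Test)

/-- Programs. -/
inductive Prog where
  | skip
  | setNat (x : ℕ) (p : NatExp)
  | setReal (x : ℕ) (p : RealExp)
  | storeNat (a : ℕ) (i p : NatExp)
  | storeReal (a : ℕ) (i : NatExp) (p : RealExp)
  | seq (p q : Prog)
  | ite (b : Test) (p q : Prog)
  | while (b : Test) (p : Prog)

/-- The value of an expression. -/
def NatExp.eval (σ : State) : NatExp → ℕ
  | const k => k
  | var x => σ.natVar x
  | arr a i => σ.natArr a (i.eval σ)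
  | add p q => p.eval σ + q.eval σ
  | sub p q => p.eval σ - q.eval σ

/-- The number of operations in the evaluation. -/
def NatExp.cost : NatExp → ℕ
  | const _ => 1
  | var _ => 1
  | arr _ i => i.cost + 1
  | add p q => p.cost + q.cost + 1
  | sub p q => p.cost + q.cost + 1

/-- The value of an expression. -/
noncomputable def RealExp.eval (σ : State) : RealExp → ℝ
  | zero => 0
  | var x => σ.realVar x
  | arr a i => σ.realArr a (i.eval σ)
  | add p q => p.eval σ + q.eval σ
  | sub p q => p.eval σ - q.eval σ

/-- The number of operations in the evaluation. -/
def RealExp.cost : RealExp → ℕ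
  | zero => 1
  | var _ => 1
  | arr _ i => i.cost + 1
  | add p q => p.cost + q.cost + 1
  | sub p q => p.cost + q.cost + 1

/-- The test succeeds. -/
def Test.Holds (σ : State) : Test → Prop
  | natEq p q => p.eval σ = q.eval σ
  | natLt p q => p.eval σ < q.eval σ
  | realEq p q => p.eval σ = q.eval σ
  | realLt p q => p.eval σ < q.eval σ
  | not b => ¬ b.Holds σ
  | and b d => b.Holds σ ∧ d.Holds σ
  | or b d => b.Holds σ ∨ d.Holds σ

/-- The number of operations in the evaluation. -/
def Test.cost : Test → ℕ
  | natEq p q => p.cost + q.cost + 1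
  | natLt p q => p.cost + q.cost + 1
  | realEq p q => p.cost + q.cost + 1
  | realLt p q => p.cost + q.cost + 1
  | not b => b.cost + 1
  | and b d => b.cost + d.cost + 1
  | or b d => b.cost + d.cost + 1

/-- The state after writing a natural-number variable. -/
def State.setNat (σ : State) (x k : ℕ) : State :=
  { σ with natVar := Function.update σ.natVar x k }

/-- The state after writing a real variable. -/
def State.setReal (σ : State) (x : ℕ) (r : ℝ) : State :=
  { σ with realVar := Function.update σ.realVar x r }

/-- The state after writing cell `i` of array `a` of natural numbers. -/
def State.storeNat (σ : State) (a i k : ℕ) : State :=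
  { σ with natArr := Function.update σ.natArr a (Function.update (σ.natArr a) i k) }

/-- The state after writing cell `i` of array `a` of reals. -/
def State.storeReal (σ : State) (a i : ℕ) (r : ℝ) : State :=
  { σ with realArr := Function.update σ.realArr a (Function.update (σ.realArr a) i r) }

/-- `Exec p σ t τ`: the program `p`, started in state `σ`, halts after `t` steps in state `τ`. -/
inductive Exec : Prog → State → ℕ → State → Prop
  | skip (σ : State) : Exec .skip σ 1 σ
  | setNat (σ : State) (x : ℕ) (p : NatExp) :
      Exec (.setNat x p) σ (p.cost + 1) (σ.setNat x (p.eval σ))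
  | setReal (σ : State) (x : ℕ) (p : RealExp) :
      Exec (.setReal x p) σ (p.cost + 1) (σ.setReal x (p.eval σ))
  | storeNat (σ : State) (a : ℕ) (i p : NatExp) :
      Exec (.storeNat a i p) σ (i.cost + p.cost + 1) (σ.storeNat a (i.eval σ) (p.eval σ))
  | storeReal (σ : State) (a : ℕ) (i : NatExp) (p : RealExp) :
      Exec (.storeReal a i p) σ (i.cost + p.cost + 1) (σ.storeReal a (i.eval σ) (p.eval σ))
  | seq {p q : Prog} {σ τ ρ : State} {s t : ℕ} :
      Exec p σ s τ → Exec q τ t ρ → Exec (.seq p q) σ (s + t) ρ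
  | ite_true {b : Test} {p q : Prog} {σ τ : State} {t : ℕ} :
      b.Holds σ → Exec p σ t τ → Exec (.ite b p q) σ (b.cost + t) τ
  | ite_false {b : Test} {p q : Prog} {σ τ : State} {t : ℕ} :
      ¬ b.Holds σ → Exec q σ t τ → Exec (.ite b p q) σ (b.cost + t) τ
  | while_true {b : Test} {p : Prog} {σ τ ρ : State} {s t : ℕ} :
      b.Holds σ → Exec p σ s τ → Exec (.while b p) τ t ρ → Exec (.while b p) σ (b.cost + s + t) ρ
  | while_false {b : Test} {p : Prog} {σ : State} :
      ¬ b.Holds σ → Exec (.while b p) σ b.cost σ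

/-! ### Presentation of a network in memory -/

/-- The duplicate-free list `L` of numbers is stored as a doubly linked list with the given first
and last element and successor and predecessor arrays; `nil` is the null pointer. -/
structure IsLinkedList (nil first last : ℕ) (next prev : ℕ → ℕ) (L : List ℕ) : Prop where
  nodup : L.Nodup
  first_eq : first = L.headD nil
  last_eq : last = L.getLastD nil
  next_eq : ∀ i (h : i < L.length), next L[i] = L.getD (i + 1) nil
  prev_eq : ∀ i (h : i < L.length), prev L[i] = (nil :: L).getD i nil

/-- `L` lists the set `A` of edges, without repetitions. -/
def Lists {V : Type u} {G : Digraph V} (L : List (Edge G)) (A : Set (Edge G)) : Prop :=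
  L.Nodup ∧ ∀ e, e ∈ L ↔ e ∈ A

/-- The memory `σ` holds the network `N` with bounds `β, γ`, where the vertices are numbered from
`0` to `n - 1` by `vnum` and the edges from `0` to `m - 1` by `enum`. The edges entering (leaving) an
internal vertex form a doubly linked list in the order of preference of that vertex; the edges
leaving a source (entering a sink) form one in any order. The number `m` is the null pointer.
All the rest of the memory is arbitrary. -/
structure Presents {V : Type u} (N : Network V) (β γ : N.Internal → ℝ≥0) {n m : ℕ}
    (vnum : V ≃ Fin n) (enum : Edge N.G ≃ Fin m) (σ : State) : Prop where
  vertex_count : σ.natVar 0 = n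
  edge_count : σ.natVar 1 = m
  kind_internal : ∀ v, N.IsInternal v → σ.natArr 0 (vnum v) = 0
  kind_source : ∀ v ∈ N.S, σ.natArr 0 (vnum v) = 1
  kind_sink : ∀ v ∈ N.T, σ.natArr 0 (vnum v) = 2
  tail_eq : ∀ e, σ.natArr 1 (enum e) = vnum e.tail
  head_eq : ∀ e, σ.natArr 2 (enum e) = vnum e.head
  out_list : ∀ v, ∃ L : List (Edge N.G), Lists L (edgesOut N.G v) ∧
    (N.IsInternal v → L.Pairwise (N.ltOut v)) ∧
    IsLinkedList m (σ.natArr 3 (vnum v)) (σ.natArr 4 (vnum v)) (σ.natArr 5) (σ.natArr 6)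
      (L.map fun e => (enum e : ℕ))
  in_list : ∀ v, ∃ L : List (Edge N.G), Lists L (edgesIn N.G v) ∧
    (N.IsInternal v → L.Pairwise (N.ltIn v)) ∧
    IsLinkedList m (σ.natArr 7 (vnum v)) (σ.natArr 8 (vnum v)) (σ.natArr 9) (σ.natArr 10)
      (L.map fun e => (enum e : ℕ))
  capacity_eq : ∀ e, σ.realArr 0 (enum e) = N.c e
  beta_eq : ∀ v : N.Internal, σ.realArr 1 (vnum v) = β v
  gamma_eq : ∀ v : N.Internal, σ.realArr 2 (vnum v) = γ v

/-- The function on the edges that the memory holds as output. -/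
def output {V : Type u} {G : Digraph V} {m : ℕ} (enum : Edge G ≃ Fin m) (σ : State) :
    Edge G → ℝ :=
  fun e => σ.realArr 3 (enum e)

end StableFlow

/-! A stable quasi-flow arises from a deferred acceptance procedure with preflows. At the start the
edges leaving sources are saturated and all others are empty. An internal vertex `v` has one list of
moves, `full v`: first increase the flow on the leaving edges, best first, as long as the excess is
above `-β v`; then decrease the flow on the entering edges, worst first, as long as the excess is
above `γ v`. The threshold belonging to the current move is `lev`. Before the flow on an edge is
decreased, the edge is closed: its residual `res (.inl e)` becomes 0 for good. A vertex never
returns to an earlier move.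

Stability (`Inv.dominated`, `isStable_of_inv`). Suppose that no vertex is active, and let `e` be
unsaturated. If `e` is open, its tail still has the increase of `e` ahead of it; so its excess is at
most `-β ≤ 0` and all its worse leaving edges are empty: domination at the start. If `e` is closed,
its head has begun to reject; so its excess is at least `γ ≥ 0`, all worse entering edges are empty,
and the head has used up all increases, so that every unsaturated edge leaving it is closed too.
Hence on an unsaturated path whose first edge is closed all edges are closed, and the last one gives
domination at the end.

Time. An event is the closing of an edge or the passage of a vertex to its next move; there are at
most `3m` events. Pushes without events could circulate for a very long time, so they are organized
in phases. A phase follows the excess from an active vertex, each vertex handing its whole surplus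
to the target of its current move. It ends at an event, or at a vertex that is not active (then the
number of active vertices has dropped), or after `n + 1` steps. In the last case the walk has run
into a cycle of current moves (`exists_cycle`); rotating the least residual round the cycle leaves
all excesses unchanged and exhausts a move, which is an event (`runs_rotate`). An event creates at
most one more active vertex, so `2 * events + |active|` drops in every phase (`runs_phase`). It is
at most `8m` at the start, and a phase together with the search for an active vertex takes time
`O(n)`.

The program is tied to this procedure by the simulation relation `Rep`. Existence follows by running
the program on a memory that presents the network. -/

namespace StableFlow

/-! ### Reasoning about programs -/

/-- The effect of a program without loops (a loop is treated as if it did nothing). -/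
noncomputable def Prog.den : Prog → State → State
  | skip, σ => σ
  | setNat x p, σ => σ.setNat x (p.eval σ)
  | setReal x p, σ => σ.setReal x (p.eval σ)
  | storeNat a i p, σ => σ.storeNat a (i.eval σ) (p.eval σ)
  | storeReal a i p, σ => σ.storeReal a (i.eval σ) (p.eval σ)
  | seq p q, σ => q.den (p.den σ)
  | ite b p q, σ => open Classical in if b.Holds σ then p.den σ else q.den σ
  | .while _ _, σ => σ

/-- The program has no loops. -/
def Prog.LoopFree : Prog → Prop
  | seq p q => p.LoopFree ∧ q.LoopFree
  | ite _ p q => p.LoopFree ∧ q.LoopFree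
  | .while _ _ => False
  | _ => True

/-- An upper bound on the running time of a program without loops. -/
def Prog.maxCost : Prog → ℕ
  | skip => 1
  | setNat _ p => p.cost + 1
  | setReal _ p => p.cost + 1
  | storeNat _ i p => i.cost + p.cost + 1
  | storeReal _ i p => i.cost + p.cost + 1
  | seq p q => p.maxCost + q.maxCost
  | ite b p q => b.cost + p.maxCost + q.maxCost
  | .while _ _ => 0

/-- Started in `σ`, the program `P` halts after at most `T` steps in a state satisfying `Q`. -/
def Runs (P : Prog) (σ : State) (T : ℕ) (Q : State → Prop) : Prop :=
  ∃ t τ, Exec P σ t τ ∧ t ≤ T ∧ Q τ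

theorem Runs.mono {P : Prog} {σ : State} {T T' : ℕ} {Q Q' : State → Prop}
    (h : Runs P σ T Q) (hT : T ≤ T') (hQ : ∀ τ, Q τ → Q' τ) : Runs P σ T' Q' := by
  obtain ⟨t, τ, h1, h2, h3⟩ := h
  exact ⟨t, τ, h1, h2.trans hT, hQ _ h3⟩

/-- Reduces straight-line code to the computation of `P.den σ`. The bound charges both branches of a
conditional, so it does not depend on the state. -/
theorem Runs.of_loopFree {P : Prog} (hP : P.LoopFree) {σ : State} {Q : State → Prop}
    (hQ : Q (P.den σ)) : Runs P σ P.maxCost Q := by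
  suffices h : ∃ t, Exec P σ t (P.den σ) ∧ t ≤ P.maxCost by
    obtain ⟨t, h1, h2⟩ := h
    exact ⟨t, _, h1, h2, hQ⟩
  clear hQ
  induction P generalizing σ with
  | skip => exact ⟨_, .skip σ, le_rfl⟩
  | setNat x p => exact ⟨_, .setNat σ x p, le_rfl⟩
  | setReal x p => exact ⟨_, .setReal σ x p, le_rfl⟩
  | storeNat a i p => exact ⟨_, .storeNat σ a i p, le_rfl⟩
  | storeReal a i p => exact ⟨_, .storeReal σ a i p, le_rfl⟩
  | seq p q ihp ihq =>
    obtain ⟨s, h1, h2⟩ := ihp hP.1 (σ := σ)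
    obtain ⟨t, h3, h4⟩ := ihq hP.2 (σ := p.den σ)
    exact ⟨s + t, .seq h1 h3, add_le_add h2 h4⟩
  | ite b p q ihp ihq =>
    by_cases hb : b.Holds σ
    · obtain ⟨s, h1, h2⟩ := ihp hP.1 (σ := σ)
      refine ⟨_, ?_, (?_ : b.cost + s ≤ b.cost + p.maxCost + q.maxCost)⟩
      · simpa only [Prog.den, if_pos hb] using Exec.ite_true hb h1
      · omega
    · obtain ⟨s, h1, h2⟩ := ihq hP.2 (σ := σ)
      refine ⟨_, ?_, (?_ : b.cost + s ≤ b.cost + p.maxCost + q.maxCost)⟩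
      · simpa only [Prog.den, if_neg hb] using Exec.ite_false hb h1
      · omega
  | _ => exact hP.elim

theorem Runs.seq {P P' : Prog} {σ : State} {S T : ℕ} {Q R : State → Prop}
    (h : Runs P σ S Q) (h' : ∀ τ, Q τ → Runs P' τ T R) : Runs (.seq P P') σ (S + T) R := by
  obtain ⟨s, τ, h1, h2, h3⟩ := h
  obtain ⟨t, ρ, h4, h5, h6⟩ := h' τ h3
  exact ⟨_, ρ, .seq h1 h4, add_le_add h2 h5, h6⟩

theorem Runs.ite {b : Test} {P P' : Prog} {σ : State} {T : ℕ} {Q : State → Prop}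
    (h : b.Holds σ → Runs P σ T Q) (h' : ¬ b.Holds σ → Runs P' σ T Q) :
    Runs (.ite b P P') σ (b.cost + T) Q := by
  by_cases hb : b.Holds σ
  · obtain ⟨t, ρ, h4, h5, h6⟩ := h hb
    exact ⟨_, ρ, .ite_true hb h4, by omega, h6⟩
  · obtain ⟨t, ρ, h4, h5, h6⟩ := h' hb
    exact ⟨_, ρ, .ite_false hb h4, by omega, h6⟩

/-- The rule for loops: `I g σ` is the invariant, with a ghost parameter `g`, and `pot g` pays for
the steps to come. -/
theorem Runs.loop {α : Type*} {b : Test} {P : Prog} (I : α → State → Prop) (pot : α → ℕ)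
    (step : ∀ g σ, I g σ → b.Holds σ →
      ∃ T, Runs P σ T fun τ => ∃ g', I g' τ ∧ b.cost + T + pot g' ≤ pot g)
    {g : α} {σ : State} (h : I g σ) :
    Runs (.while b P) σ (pot g + b.cost) fun τ => ∃ g', I g' τ ∧ ¬ b.Holds τ := by
  induction hk : pot g using Nat.strong_induction_on generalizing g σ with
  | _ k ih =>
    by_cases hb : b.Holds σ
    · obtain ⟨T, t, τ, h1, h2, g', h3, h4⟩ := step g σ h hb
      have hpos : 0 < b.cost := by cases b <;> simp [Test.cost]
      obtain ⟨s, ρ, h5, h6, h7⟩ := ih (pot g') (by omega) h3 rfl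
      exact ⟨_, ρ, .while_true hb h1 h5, by omega, h7⟩
    · exact ⟨_, σ, .while_false hb, by omega, g, h, hb⟩

/-- In a duplicate-free list an element determines what follows it. This compares positions in the
list of remaining moves with positions in `full`. -/
theorem eq_of_append_cons_eq {α : Type*} {a : α} {p q l l' : List α} (hn : (p ++ a :: l).Nodup)
    (h : p ++ a :: l = q ++ a :: l') : l = l' := by
  have hn' := h ▸ hn
  have h1 : a ∉ p := fun hm => (List.nodup_append'.1 hn).2.2 hm (by simp)
  have h2 : a ∉ q := fun hm => (List.nodup_append'.1 hn').2.2 hm (by simp)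
  rw [List.append_eq_append_iff] at h
  obtain ⟨t, h3, h4⟩ | ⟨t, h3, h4⟩ := h
  · cases t with
    | nil => simpa using h4
    | cons b t =>
      simp only [List.cons_append, List.cons.injEq] at h4
      exact absurd (by rw [h3, ← h4.1]; simp) h2
  · cases t with
    | nil => simpa using h4.symm
    | cons b t =>
      simp only [List.cons_append, List.cons.injEq] at h4
      exact absurd (by rw [h3, ← h4.1]; simp) h1

/-! ### The abstract algorithm -/

/-- The data on which the algorithm works: a network whose vertices have been given lists of
entering and leaving edges. -/
structure Market (V E : Type*) where
  /-- the vertex that an edge leaves -/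
  tail : E → V
  /-- the vertex that an edge enters -/
  head : E → V
  /-- the capacities -/
  cap : E → ℝ
  /-- the internal vertices -/
  internal : V → Prop
  /-- the deficit allowed at a vertex -/
  low : V → ℝ
  /-- the excess allowed at a vertex -/
  high : V → ℝ
  /-- the edges leaving a vertex -/
  outL : V → List E
  /-- the edges entering a vertex -/
  inL : V → List E
  cap_nonneg : ∀ e, 0 ≤ cap e
  low_nonneg : ∀ v, 0 ≤ low v
  high_nonneg : ∀ v, 0 ≤ high v
  nodup_outL : ∀ v, (outL v).Nodup
  nodup_inL : ∀ v, (inL v).Nodup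
  mem_outL : ∀ v e, e ∈ outL v ↔ tail e = v
  mem_inL : ∀ v e, e ∈ inL v ↔ head e = v

/-- A state of the algorithm. The move `.inl e` is the increase of the flow on the edge `e`, made by
its tail; the move `.inr e` is the decrease of that flow, made by the head of `e`. -/
structure Config (V E : Type*) where
  /-- by how much a move may still be made; `res (.inr e)` is the flow on `e` -/
  res : E ⊕ E → ℝ
  /-- the moves that a vertex may still make, in the order in which it makes them -/
  cur : V → List (E ⊕ E)

namespace Config

variable {V E : Type*} (s : Config V E)

/-- The flow on an edge. -/
def flow (e : E) : ℝ := s.res (.inr e)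

/-- Make the move `a` by the amount `δ`. -/
noncomputable def push (a : E ⊕ E) (δ : ℝ) : Config V E where
  res := open Classical in match a with
    | .inl e => Function.update (Function.update s.res (.inl e) (s.res (.inl e) - δ)) (.inr e)
        (s.res (.inr e) + δ)
    | .inr e => Function.update s.res (.inr e) (s.res (.inr e) - δ)
  cur := s.cur

/-- Forbid any further increase of the flow on `e`. -/
noncomputable def close (e : E) : Config V E where
  res := open Classical in Function.update s.res (.inl e) 0
  cur := s.cur

/-- Let the vertex `x` pass to its next move. -/
noncomputable def advance (x : V) : Config V E where
  res := s.res
  cur := open Classical in Function.update s.cur x (s.cur x).tail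

theorem flow_close (e : E) : (s.close e).flow = s.flow := by
  ext e'
  simp [Config.flow, Config.close]

end Config

/-! ### Moves and the combinatorial invariant -/

namespace Market

variable {V E : Type*} (M : Market V E)

/-- The vertex that makes the move. -/
def owner : E ⊕ E → V := Sum.elim M.tail M.head

/-- The vertex to which the move brings excess. -/
def target : E ⊕ E → V := Sum.elim M.head M.tail

/-- All moves of a vertex, in the order in which it makes them. -/
def full (v : V) : List (E ⊕ E) := (M.outL v).map .inl ++ (M.inL v).reverse.map .inr

theorem mem_full {v : V} {a : E ⊕ E} : a ∈ M.full v ↔ M.owner a = v := by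
  cases a <;> simp [full, owner, M.mem_outL, M.mem_inL]

theorem nodup_full (v : V) : (M.full v).Nodup := by
  refine List.Nodup.append ?_ ?_ ?_
  · exact (M.nodup_outL v).map Sum.inl_injective
  · exact (List.nodup_reverse.2 (M.nodup_inL v)).map Sum.inr_injective
  · intro a h1 h2
    simp only [List.mem_map] at h1 h2
    obtain ⟨e, _, rfl⟩ := h1
    obtain ⟨e', _, h⟩ := h2
    exact absurd h (by simp)

/-- Decreases come after all increases in `full`: a vertex that has begun to reject never offers
again. -/
theorem eq_inr_of_mem {v : V} {e : E} {l : List (E ⊕ E)} (h : .inr e :: l <:+ M.full v)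
    {a : E ⊕ E} (ha : a ∈ l) : ∃ e', a = .inr e' := by
  obtain ⟨p, hp⟩ := h
  rw [full, List.append_eq_append_iff] at hp
  obtain ⟨q, h1, h2⟩ | ⟨q, h1, h2⟩ := hp
  · cases q with
    | nil =>
      have : a ∈ List.map Sum.inr (M.inL v).reverse := by
        simp only [List.nil_append] at h2
        rw [← h2]; simp [ha]
      obtain ⟨e', _, rfl⟩ := List.mem_map.1 this
      exact ⟨e', rfl⟩
    | cons b q =>
      simp only [List.cons_append, List.cons.injEq] at h2
      have : b ∈ List.map (Sum.inl : E → E ⊕ E) (M.outL v) := by rw [h1]; simp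
      obtain ⟨e', _, h⟩ := List.mem_map.1 this
      rw [← h2.1] at h
      simp at h
  · have : a ∈ List.map Sum.inr (M.inL v).reverse := by
      rw [h2]; simp [ha]
    obtain ⟨e', _, rfl⟩ := List.mem_map.1 this
    exact ⟨e', rfl⟩

/-- The excess that a vertex does not try to get rid of by its current move. -/
noncomputable def lev (s : Config V E) (v : V) : ℝ :=
  match s.cur v with
  | .inl _ :: _ => -M.low v
  | _ => M.high v

/-- The vertex `x` may make the move `a`: the increase of the flow must be forbidden before the flow
may be decreased. -/
structure Ready (s : Config V E) (x : V) (a : E ⊕ E) : Prop where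
  internal : M.internal x
  cur_eq : ∃ l, s.cur x = a :: l
  res_eq_zero : ∀ e, a = .inr e → s.res (.inl e) = 0

/-- No increase is possible on the edge, although it is not saturated. -/
def Closed (s : Config V E) (e : E) : Prop := s.res (.inl e) = 0 ∧ s.flow e < M.cap e

/-- The invariant of the algorithm that does not involve the excesses. -/
structure Inv (s : Config V E) : Prop where
  nonneg : ∀ a, 0 ≤ s.res a
  flow_le : ∀ e, s.flow e ≤ M.cap e
  res_inl : ∀ e, s.res (.inl e) = 0 ∨ s.res (.inl e) = M.cap e - s.flow e
  suffix : ∀ v, M.internal v → s.cur v <:+ M.full v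
  of_notMem_inl : ∀ e, .inl e ∉ s.cur (M.tail e) → s.res (.inl e) = 0
  of_notMem_inr : ∀ e, M.internal (M.head e) → .inr e ∉ s.cur (M.head e) →
    s.res (.inl e) = 0 ∧ s.flow e = 0
  -- The head of a closed edge has reached or passed the rejection of that edge; terminals never
  -- reject.
  of_closed : ∀ e, M.Closed s e → M.internal (M.head e) ∧
    ∃ l, .inr e :: l <:+ M.full (M.head e) ∧ s.cur (M.head e) <:+ .inr e :: l
  -- Increases behind the current move have not begun, and such edges have been empty from the
  -- start.
  of_mem_tail : ∀ e, .inl e ∈ (s.cur (M.tail e)).tail → s.flow e = 0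
  cur_eq_nil : ∀ v, ¬ M.internal v → s.cur v = []

variable {M} {s : Config V E}

theorem Ready.owner_eq (hs : M.Inv s) {x : V} {a : E ⊕ E} (h : M.Ready s x a) :
    M.owner a = x := by
  obtain ⟨l, hl⟩ := h.cur_eq
  exact M.mem_full.1 ((hs.suffix x h.internal).subset (by simp [hl]))

theorem Inv.notMem_tail (hs : M.Inv s) {x : V} (hx : M.internal x) {a : E ⊕ E} {l : List (E ⊕ E)}
    (h : s.cur x = a :: l) : a ∉ l := by
  have := (M.nodup_full x).sublist (hs.suffix x hx).sublist
  rw [h] at this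
  exact (List.nodup_cons.1 this).1

theorem Inv.exists_inr_cons (hs : M.Inv s) {e : E} (h : M.Closed s e) :
    ∀ a ∈ s.cur (M.head e), ∃ e', a = .inr e' := by
  obtain ⟨_, l, h1, h2⟩ := hs.of_closed e h
  intro a ha
  rcases List.mem_cons.1 (h2.subset ha) with h | h
  · exact ⟨e, h⟩
  · exact M.eq_inr_of_mem h1 h

theorem lev_of_forall (x : V) (h : ∀ a ∈ s.cur x, ∃ e', a = .inr e') : M.lev s x = M.high x := by
  unfold lev
  split
  · next e l hl =>
    obtain ⟨e', h⟩ := h (.inl e) (by simp [hl])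
    simp at h
  · rfl

theorem neg_low_le_lev (x : V) : -M.low x ≤ M.lev s x := by
  have := M.low_nonneg x
  have := M.high_nonneg x
  unfold lev
  split <;> linarith

/-- An increase takes from the residual what it adds to the flow, so `cap - flow` is preserved; if
the edge has residual 0, then `δ = 0`. A decrease may leave its edge closed and unsaturated, and
then the current move of the head is the witness for `of_closed`. -/
theorem Inv.push (hs : M.Inv s) {x : V} {a : E ⊕ E} (ha : M.Ready s x a) {δ : ℝ} (h0 : 0 ≤ δ)
    (hδ : δ ≤ s.res a) : M.Inv (s.push a δ) := by
  have hown := ha.owner_eq hs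
  obtain ⟨l, hl⟩ := ha.cur_eq
  cases a with
  | inl e =>
    change M.tail e = x at hown
    have r1 : (s.push (.inl e) δ).res (.inl e) = s.res (.inl e) - δ := by simp [Config.push]
    have r2 : (s.push (.inl e) δ).flow e = s.flow e + δ := by simp [Config.push, Config.flow]
    have r3 : ∀ e', e' ≠ e → (s.push (.inl e) δ).res (.inl e') = s.res (.inl e') := by
      intro e' h; simp [Config.push, h]
    have r4 : ∀ e', e' ≠ e → (s.push (.inl e) δ).flow e' = s.flow e' := by
      intro e' h; simp [Config.push, Config.flow, h]
    have hc := hs.res_inl e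
    have hle := hs.flow_le e
    refine ⟨?_, ?_, ?_, hs.suffix, ?_, ?_, ?_, ?_, hs.cur_eq_nil⟩
    · rintro (e' | e')
      · by_cases h : e' = e
        · subst h; rw [r1]; linarith
        · rw [r3 _ h]; exact hs.nonneg _
      · change 0 ≤ (s.push (.inl e) δ).flow e'
        by_cases h : e' = e
        · subst h; rw [r2]; exact add_nonneg (hs.nonneg _) h0
        · rw [r4 _ h]; exact hs.nonneg _
    · intro e'
      by_cases h : e' = e
      · subst h; rw [r2]
        rcases hc with hc | hc <;> linarith
      · rw [r4 _ h]; exact hs.flow_le _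
    · intro e'
      by_cases h : e' = e
      · subst h; rw [r1, r2]
        rcases hc with hc | hc
        · left; linarith
        · right; linarith
      · rw [r3 _ h, r4 _ h]; exact hs.res_inl _
    · intro e' he'
      have h : e' ≠ e := by
        rintro rfl
        exact he' (by rw [hown]; change _ ∈ s.cur x; simp [hl])
      rw [r3 _ h]; exact hs.of_notMem_inl _ he'
    · intro e' hi he'
      have h1 := hs.of_notMem_inr e' hi he'
      by_cases h : e' = e
      · subst h; rw [r1, r2]
        constructor <;> linarith [h1.1, h1.2]
      · rw [r3 _ h, r4 _ h]; exact h1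
    · intro e' he'
      refine hs.of_closed e' ?_
      by_cases h : e' = e
      · subst h
        rw [Closed, r1, r2] at he'
        refine ⟨?_, by linarith [he'.2]⟩
        rcases hc with hc | hc
        · exact hc
        · linarith [he'.1, he'.2]
      · rw [Closed, r3 _ h, r4 _ h] at he'
        exact he'
    · intro e' he'
      -- The edge being increased is at the front of a duplicate-free list, hence not behind it.
      have h : e' ≠ e := by
        rintro rfl
        refine hs.notMem_tail ha.internal hl ?_
        have : Sum.inl e' ∈ (s.cur (M.tail e')).tail := he'
        rwa [hown, hl] at this
      rw [r4 _ h]; exact hs.of_mem_tail _ he'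
  | inr e =>
    change M.head e = x at hown
    have hz := ha.res_eq_zero e rfl
    have r1 : ∀ e', (s.push (.inr e) δ).res (.inl e') = s.res (.inl e') := by
      intro e'; simp [Config.push]
    have r2 : (s.push (.inr e) δ).flow e = s.flow e - δ := by simp [Config.push, Config.flow]
    have r4 : ∀ e', e' ≠ e → (s.push (.inr e) δ).flow e' = s.flow e' := by
      intro e' h; simp [Config.push, Config.flow, h]
    change δ ≤ s.flow e at hδ
    refine ⟨?_, ?_, ?_, hs.suffix, ?_, ?_, ?_, ?_, hs.cur_eq_nil⟩
    · rintro (e' | e')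
      · rw [r1]; exact hs.nonneg _
      · change 0 ≤ (s.push (.inr e) δ).flow e'
        by_cases h : e' = e
        · subst h; rw [r2]; linarith
        · rw [r4 _ h]; exact hs.nonneg _
    · intro e'
      by_cases h : e' = e
      · subst h; rw [r2]; linarith [hs.flow_le e']
      · rw [r4 _ h]; exact hs.flow_le _
    · intro e'
      rw [r1]
      by_cases h : e' = e
      · subst h; exact .inl hz
      · rw [r4 _ h]; exact hs.res_inl _
    · intro e' he'
      rw [r1]; exact hs.of_notMem_inl _ he'
    · intro e' hi he'
      have h1 := hs.of_notMem_inr e' hi he'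
      rw [r1]
      refine ⟨h1.1, ?_⟩
      by_cases h : e' = e
      · subst h; rw [r2]; linarith [h1.2]
      · rw [r4 _ h]; exact h1.2
    · intro e' he'
      by_cases h : e' = e
      · subst h
        rw [hown]
        exact ⟨ha.internal, l, hl ▸ hs.suffix x ha.internal, hl ▸ List.suffix_rfl⟩
      · rw [Closed, r1, r4 _ h] at he'
        exact hs.of_closed e' he'
    · intro e' he'
      have h1 := hs.of_mem_tail e' he'
      by_cases h : e' = e
      · subst h; rw [r2]; linarith
      · rw [r4 _ h]; exact h1

/-- The only edge that can become closed is `e`, and its rejection is the current move of its head.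
-/
theorem Inv.close (hs : M.Inv s) {x : V} (hx : M.internal x) {e : E} {l : List (E ⊕ E)}
    (hl : s.cur x = .inr e :: l) : M.Inv (s.close e) := by
  have hown : M.head e = x := M.mem_full.1 ((hs.suffix x hx).subset (a := .inr e) (by simp [hl]))
  have r1 : (s.close e).res (.inl e) = 0 := by simp [Config.close]
  have r3 : ∀ e', e' ≠ e → (s.close e).res (.inl e') = s.res (.inl e') := by
    intro e' h; simp [Config.close, h]
  have r4 := s.flow_close e
  refine ⟨?_, ?_, ?_, hs.suffix, ?_, ?_, ?_, ?_, hs.cur_eq_nil⟩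
  · rintro (e' | e')
    · by_cases h : e' = e
      · subst h; rw [r1]
      · rw [r3 _ h]; exact hs.nonneg _
    · change 0 ≤ (s.close e).flow e'
      rw [r4]; exact hs.nonneg _
  · rw [r4]; exact hs.flow_le
  · intro e'
    by_cases h : e' = e
    · subst h; exact .inl r1
    · rw [r3 _ h, r4]; exact hs.res_inl _
  · intro e' he'
    by_cases h : e' = e
    · subst h; exact r1
    · rw [r3 _ h]; exact hs.of_notMem_inl _ he'
  · intro e' hi he'
    have h1 := hs.of_notMem_inr e' hi he'
    rw [r4]
    refine ⟨?_, h1.2⟩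
    by_cases h : e' = e
    · subst h; exact r1
    · rw [r3 _ h]; exact h1.1
  · intro e' he'
    by_cases h : e' = e
    · subst h
      rw [hown]
      exact ⟨hx, l, hl ▸ hs.suffix x hx, hl ▸ List.suffix_rfl⟩
    · rw [Closed, r3 _ h, r4] at he'
      exact hs.of_closed e' he'
  · rw [r4]; exact hs.of_mem_tail

/-- An increase that uses up the residual saturates its edge, so only a decrease can produce a new
closed edge, and it is made by the head. -/
theorem Inv.closed_push (hs : M.Inv s) {x : V} {a : E ⊕ E} (ha : M.Ready s x a) {δ : ℝ} {e : E}
    (he : M.Closed (s.push a δ) e) : M.Closed s e ∨ M.head e = x := by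
  have hown := ha.owner_eq hs
  cases a with
  | inl e' =>
    left
    by_cases hee : e = e'
    · subst hee
      have r1 : (s.push (.inl e) δ).res (.inl e) = s.res (.inl e) - δ := by simp [Config.push]
      have r2 : (s.push (.inl e) δ).flow e = s.flow e + δ := by simp [Config.push, Config.flow]
      rw [Closed, r1, r2] at he
      rcases hs.res_inl e with hc | hc
      · exact ⟨hc, by linarith [he.1, he.2]⟩
      · linarith [he.1, he.2]
    · simpa [Closed, Config.push, Config.flow, hee] using he
  | inr e' =>
    by_cases hee : e = e'
    · subst hee; exact .inr hown
    · left
      simpa [Closed, Config.push, Config.flow, hee] using he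

theorem cur_advance_suffix (s : Config V E) (x v : V) : (s.advance x).cur v <:+ s.cur v := by
  by_cases h : v = x
  · subst h
    simpa [Config.advance] using List.tail_suffix _
  · simp [Config.advance, h]

/-- Only the exhausted move `a` leaves a list. If it is a decrease, readiness gives that its edge
has been closed before. -/
theorem Inv.advance (hs : M.Inv s) {x : V} {a : E ⊕ E} (ha : M.Ready s x a) (h0 : s.res a = 0) :
    M.Inv (s.advance x) := by
  have hown := ha.owner_eq hs
  obtain ⟨l, hl⟩ := ha.cur_eq
  have hcx : (s.advance x).cur x = l := by simp [Config.advance, hl]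
  have hmem : ∀ b, b ≠ a → b ∈ s.cur (M.owner b) → b ∈ (s.advance x).cur (M.owner b) := by
    intro b hb h
    by_cases hx : M.owner b = x
    · rw [hx] at h ⊢
      rw [hcx]
      rw [hl] at h
      exact (List.mem_cons.1 h).resolve_left hb
    · simpa [Config.advance, hx] using h
  refine ⟨hs.nonneg, hs.flow_le, hs.res_inl, ?_, ?_, ?_, ?_, ?_, ?_⟩
  · exact fun v hv => (cur_advance_suffix s x v).trans (hs.suffix v hv)
  · intro e he
    by_cases h : Sum.inl e = a
    · subst h; exact h0
    · exact hs.of_notMem_inl e fun h' => he (hmem _ h h')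
  · intro e hi he
    by_cases h : Sum.inr e = a
    · subst h; exact ⟨ha.res_eq_zero e rfl, h0⟩
    · exact hs.of_notMem_inr e hi fun h' => he (hmem _ h h')
  · intro e he
    obtain ⟨h1, l', h2, h3⟩ := hs.of_closed e he
    exact ⟨h1, l', h2, (cur_advance_suffix s x _).trans h3⟩
  · intro e he
    refine hs.of_mem_tail e ?_
    obtain ⟨p, hp⟩ := cur_advance_suffix s x (M.tail e)
    rw [← hp]
    cases p with
    | nil => exact he
    | cons b p =>
      simp only [List.cons_append, List.tail_cons]
      exact List.mem_append_right _ (List.mem_of_mem_tail he)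
  · intro v hv
    exact List.suffix_nil.1 (hs.cur_eq_nil v hv ▸ cur_advance_suffix s x v)

/-- The level changes at most from `-low` to `high`, as increases precede decreases; hence passing
to the next move activates nobody. -/
theorem Inv.lev_le_advance (hs : M.Inv s) {x : V} (hx : M.internal x) (v : V) :
    M.lev s v ≤ M.lev (s.advance x) v := by
  by_cases hv : v = x
  · subst hv
    cases hc : s.cur v with
    | nil => simp [lev, Config.advance, hc]
    | cons a l =>
      cases a with
      | inl e =>
        have : M.lev s v = -M.low v := by simp [lev, hc]
        rw [this]
        exact neg_low_le_lev v
      | inr e =>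
        rw [lev_of_forall, lev_of_forall]
        · intro a ha
          simp only [Config.advance, Function.update_self, hc, List.tail_cons] at ha
          exact M.eq_inr_of_mem (hc ▸ hs.suffix v hx) ha
        · intro a ha
          rw [hc] at ha
          rcases List.mem_cons.1 ha with h | h
          · exact ⟨e, h⟩
          · exact M.eq_inr_of_mem (hc ▸ hs.suffix v hx) h
  · simp [lev, Config.advance, hv]

/-! ### Excesses, activity, and domination at termination -/

variable (M) [Fintype E]

/-- The excess at a vertex. -/
noncomputable def excess (f : E → ℝ) (v : V) : ℝ :=
  open Classical in ∑ e, ((if M.head e = v then f e else 0) - if M.tail e = v then f e else 0)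

theorem excess_update [DecidableEq E] [DecidableEq V] (f : E → ℝ) (e : E) (δ : ℝ) (v : V) :
    M.excess (Function.update f e (f e + δ)) v =
      M.excess f v + ((if M.head e = v then δ else 0) - if M.tail e = v then δ else 0) := by
  classical
  unfold excess
  rw [← Finset.add_sum_erase _ _ (Finset.mem_univ e),
    ← Finset.add_sum_erase _ _ (Finset.mem_univ e)]
  have : ∀ e' ∈ Finset.univ.erase e, Function.update f e (f e + δ) e' = f e' := by
    intro e' he'
    exact Function.update_of_ne (Finset.ne_of_mem_erase he') _ _
  rw [Finset.sum_congr rfl (fun e' he' => by rw [this e' he'])]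
  simp only [Function.update_self]
  split_ifs <;> ring

/-- The excess at a vertex. -/
noncomputable abbrev ex (s : Config V E) (v : V) : ℝ := M.excess s.flow v

open Classical in
theorem ex_push (s : Config V E) (a : E ⊕ E) (δ : ℝ) (v : V) :
    M.ex (s.push a δ) v =
      M.ex s v - (if v = M.owner a then δ else 0) + if v = M.target a then δ else 0 := by
  cases a with
  | inl e =>
    have : (s.push (.inl e) δ).flow = Function.update s.flow e (s.flow e + δ) := by
      ext e'
      by_cases h : e' = e <;> simp [Config.flow, Config.push, h]
    rw [ex, this, excess_update]
    simp only [owner, target, Sum.elim_inl, eq_comm (a := v)]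
    ring
  | inr e =>
    have : (s.push (.inr e) δ).flow = Function.update s.flow e (s.flow e + -δ) := by
      ext e'
      by_cases h : e' = e <;> simp [Config.flow, Config.push, h, sub_eq_add_neg]
    rw [ex, this, excess_update]
    simp only [owner, target, Sum.elim_inr, eq_comm (a := v)]
    split_ifs <;> ring

/-- The vertex has to make a move. -/
def Active (s : Config V E) (v : V) : Prop := M.internal v ∧ M.lev s v < M.ex s v

/-- The invariant on the excesses. -/
structure LowerBound (s : Config V E) : Prop where
  low_le : ∀ v, M.internal v → -M.low v ≤ M.ex s v
  high_le : ∀ e, M.Closed s e → M.high (M.head e) ≤ M.ex s (M.head e)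

variable {M}

/-- A vertex that has used up its moves has emptied all entering edges, so its excess is at most 0,
which does not exceed its level `high`. -/
theorem Active.exists_cons (hs : M.Inv s) {x : V} (h : M.Active s x) : ∃ a l, s.cur x = a :: l := by
  by_contra! hne
  have hnil : s.cur x = [] := by
    cases hc : s.cur x with
    | nil => rfl
    | cons a l => exact absurd hc (hne a l)
  have h1 := h.2
  have h2 : M.ex s x ≤ 0 := by
    refine Finset.sum_nonpos fun e _ => ?_
    have h0 : 0 ≤ s.flow e := hs.nonneg _
    by_cases he : M.head e = x
    · have : s.flow e = 0 :=
        (hs.of_notMem_inr e (he ▸ h.1) (by rw [he, hnil]; simp)).2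
      simp [this]
    · rw [if_neg he]
      split_ifs <;> simp [h0]
  rw [lev_of_forall x (by simp [hnil])] at h1
  linarith [M.high_nonneg x]

/-- The owner gives away no more than its surplus over its level, and no other vertex loses excess.
The head of a closed edge has level `high`. -/
theorem LowerBound.push (h : M.LowerBound s) (hs : M.Inv s) {x : V} {a : E ⊕ E}
    (ha : M.Ready s x a) {δ : ℝ} (h0 : 0 ≤ δ) (hδ : δ ≤ s.res a) (hx : δ ≤ M.ex s x - M.lev s x) :
    M.LowerBound (s.push a δ) := by
  have hown := ha.owner_eq hs
  obtain ⟨l, hl⟩ := ha.cur_eq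
  have key : ∀ v, (v = x ∧ M.lev s x ≤ M.ex (s.push a δ) v) ∨
      v ≠ x ∧ M.ex s v ≤ M.ex (s.push a δ) v := by
    intro v
    rw [ex_push, hown]
    by_cases hv : v = x
    · left
      subst hv
      refine ⟨rfl, ?_⟩
      split_ifs <;> simp <;> linarith
    · right
      refine ⟨hv, ?_⟩
      split_ifs <;> simp [h0]
  have hhigh := fun e => hs.closed_push ha (δ := δ) (e := e)
  constructor
  · intro v hv
    rcases key v with ⟨rfl, h1⟩ | ⟨_, h1⟩
    · exact (neg_low_le_lev v).trans h1
    · exact (h.low_le v hv).trans h1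
  · intro e he
    have hinv := hs.push ha h0 hδ
    -- The push does not change the lists of moves, so the level may be computed after it.
    have hlev : M.lev s (M.head e) = M.high (M.head e) :=
      lev_of_forall (s := s) _ (hinv.exists_inr_cons he)
    rcases key (M.head e) with ⟨h2, h1⟩ | ⟨h2, h1⟩
    · rw [← hlev, h2]; rwa [h2] at h1
    · rcases hhigh e he with h3 | h3
      · exact (h.high_le e h3).trans h1
      · exact absurd h3 h2

/-- At this moment the head is active with a decrease as current move, so its excess exceeds `high`.
-/
theorem LowerBound.close (h : M.LowerBound s) (hs : M.Inv s) {x : V} (hx : M.Active s x) {e : E}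
    {l : List (E ⊕ E)} (hl : s.cur x = .inr e :: l) : M.LowerBound (s.close e) := by
  have hown : M.head e = x := M.mem_full.1 ((hs.suffix x hx.1).subset (a := .inr e) (by simp [hl]))
  constructor
  · intro v hv; simpa only [ex, s.flow_close e] using h.low_le v hv
  · intro e' he'
    simp only [ex, s.flow_close e]
    by_cases hee : e' = e
    · subst hee
      rw [hown]
      have : M.lev s x = M.high x := by simp [lev, hl]
      rw [← this]
      exact hx.2.le
    · refine h.high_le e' ?_
      rw [Closed, s.flow_close] at he'
      simpa [Closed, Config.close, hee] using he'

theorem LowerBound.advance (h : M.LowerBound s) (x : V) : M.LowerBound (s.advance x) :=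
  ⟨h.low_le, h.high_le⟩

/-- What remains when no vertex has to make a move. -/
theorem Inv.dominated (hs : M.Inv s) (h : M.LowerBound s) (hact : ∀ v, ¬ M.Active s v) {e : E}
    (he : s.flow e < M.cap e) :
    (s.res (.inl e) ≠ 0 → M.internal (M.tail e) ∧ M.ex s (M.tail e) ≤ 0 ∧
      ∀ p l, M.outL (M.tail e) = p ++ e :: l → ∀ e' ∈ l, s.flow e' = 0) ∧
    (s.res (.inl e) = 0 → M.internal (M.head e) ∧ 0 ≤ M.ex s (M.head e) ∧
      (∀ p l, M.inL (M.head e) = p ++ e :: l → ∀ e' ∈ l, s.flow e' = 0) ∧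
      ∀ e', M.tail e' = M.head e → s.res (.inl e') = 0) := by
  refine ⟨fun hz => ?_, fun hz => ?_⟩
  swap
  · obtain ⟨h1, l', h2, h3⟩ := hs.of_closed e ⟨hz, he⟩
    refine ⟨h1, (M.high_nonneg _).trans (h.high_le e ⟨hz, he⟩), ?_, ?_⟩
    · intro p l hp e' he'
      have hmem : e' ∈ M.inL (M.head e) := by rw [hp]; simp [he']
      have hown := (M.mem_inL _ _).1 hmem
      refine (hs.of_notMem_inr e' (hown ▸ h1) ?_).2
      rw [hown]
      intro hc
      have hc := h3.subset hc
      have hnd := M.nodup_full (M.head e)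
      -- Entering edges are rejected in reverse order, so behind the rejection of `e` there are only
      -- the edges `p` preferred to `e`; the worse edges `l` have been dealt with.
      have hf : M.full (M.head e) = (M.outL (M.head e)).map .inl ++
          ((l.reverse).map .inr ++ .inr e :: p.reverse.map .inr) := by
        simp [full, hp]
      have hl' : l' = p.reverse.map .inr := by
        obtain ⟨q, hq⟩ := h2
        rw [hf, ← List.append_assoc] at hq
        exact eq_of_append_cons_eq (by rw [hq, List.append_assoc, ← hf]; exact hnd) hq
      rw [hl'] at hc
      have hin := M.nodup_inL (M.head e)
      rw [hp] at hin
      have hin' := List.nodup_append'.1 hin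
      rcases List.mem_cons.1 hc with hc | hc
      · have : e' = e := by simpa using hc
        subst this
        exact (List.nodup_cons.1 hin'.2.1).1 he'
      · have : e' ∈ p := by simpa using hc
        exact hin'.2.2 this (by simp [he'])
    · intro e' he'
      refine hs.of_notMem_inl e' fun hc => ?_
      -- A remaining increase would contradict that the head of a closed edge has only decreases
      -- left.
      rw [he'] at hc
      obtain ⟨e'', h⟩ := hs.exists_inr_cons ⟨hz, he⟩ _ hc
      simp at h
  · have hmem : Sum.inl e ∈ s.cur (M.tail e) := by
      by_contra hc
      exact hz (hs.of_notMem_inl e hc)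
    have hi : M.internal (M.tail e) := by
      by_contra hc
      rw [hs.cur_eq_nil _ hc] at hmem
      simp at hmem
    have hsuf := hs.suffix _ hi
    cases hcur : s.cur (M.tail e) with
    | nil => simp [hcur] at hmem
    | cons a l0 =>
      rw [hcur] at hmem hsuf
      refine ⟨hi, ?_, ?_⟩
      -- An increase is still ahead, so the current move is an increase too and the level is `-low`.
      · have h1 : M.lev s (M.tail e) = -M.low (M.tail e) := by
          cases a with
          | inl e' => simp [lev, hcur]
          | inr e' =>
            rcases List.mem_cons.1 hmem with h | h
            · simp at h
            · obtain ⟨_, h⟩ := M.eq_inr_of_mem hsuf h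
              simp at h
        have h2 : M.ex s (M.tail e) ≤ M.lev s (M.tail e) := by
          by_contra hc
          exact hact _ ⟨hi, not_le.1 hc⟩
        linarith [M.low_nonneg (M.tail e)]
      · intro p l hp e' he'
        have hmem' : e' ∈ M.outL (M.tail e) := by rw [hp]; simp [he']
        have hown := (M.mem_outL _ _).1 hmem'
        refine hs.of_mem_tail e' ?_
        rw [hown, hcur, List.tail_cons]
        have hf : M.full (M.tail e) = p.map .inl ++ .inl e ::
            (l.map .inl ++ (M.inL (M.tail e)).reverse.map .inr) := by
          simp [full, hp]
        have hnd := M.nodup_full (M.tail e)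
        obtain ⟨q, hq⟩ := hsuf
        obtain ⟨l1, l2, h12⟩ := List.append_of_mem hmem
        -- The remaining list is a suffix of `full`, so everything after `e` in `full` is still
        -- there, and behind the current move.
        rw [h12, ← List.append_assoc, hf] at hq
        have hl2 := eq_of_append_cons_eq (hq ▸ hf ▸ hnd) hq
        have : Sum.inl e' ∈ l2 := by rw [hl2]; simp [he']
        cases l1 with
        | nil =>
          simp only [List.nil_append, List.cons.injEq] at h12
          rw [h12.2]; exact this
        | cons b l1 =>
          simp only [List.cons_append, List.cons.injEq] at h12
          rw [h12.2]; simp [this]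

end Market
end StableFlow

namespace StableFlow
namespace Market

variable {V E : Type*} {M : Market V E} {s : Config V E}

/-! ### Counting -/

theorem res_push_of_ne (s : Config V E) {a b : E ⊕ E} (hab : b ≠ a)
    (h : ∀ e, a = .inl e → b ≠ .inr e) (δ : ℝ) : (s.push a δ).res b = s.res b := by
  cases a with
  | inl e => simp [Config.push, hab, h e rfl]
  | inr e => simp [Config.push, hab]

theorem res_push_self (s : Config V E) (a : E ⊕ E) (δ : ℝ) :
    (s.push a δ).res a = s.res a - δ := by
  cases a <;> simp [Config.push]

theorem res_inl_push_eq_zero {a : E ⊕ E} {δ : ℝ} (h0 : 0 ≤ δ)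
    (hδ : δ ≤ s.res a) {e : E} (he : s.res (.inl e) = 0) : (s.push a δ).res (.inl e) = 0 := by
  by_cases h : Sum.inl e = a
  · subst h
    rw [res_push_self]
    linarith
  · rw [res_push_of_ne s h (by simp), he]

/-- Other pushes never reopen a closed edge, so readiness persists along a walk. -/
theorem Ready.push {a : E ⊕ E} {δ : ℝ} (h0 : 0 ≤ δ) (hδ : δ ≤ s.res a) {v : V}
    {b : E ⊕ E} (h : M.Ready s v b) : M.Ready (s.push a δ) v b :=
  ⟨h.internal, h.cur_eq, fun e he => res_inl_push_eq_zero h0 hδ (h.res_eq_zero e he)⟩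

theorem lev_congr {s' : Config V E} (h : s'.cur = s.cur) (v : V) : M.lev s' v = M.lev s v := by
  simp [lev, h]

/-- The vertex to which the current move of `v` leads. -/
noncomputable def succ (M : Market V E) (s : Config V E) (v : V) : V :=
  match s.cur v with
  | a :: _ => M.target a
  | [] => v

theorem Ready.succ_eq {v : V} {a : E ⊕ E} (h : M.Ready s v a) : succ M s v = M.target a := by
  obtain ⟨l, hl⟩ := h.cur_eq
  simp [succ, hl]

theorem succ_congr {s' : Config V E} (h : s'.cur = s.cur) : succ M s' = succ M s := by
  funext v
  simp [succ, h]

variable [Fintype E]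

variable (M) in
/-- The number of changes of moves and of prohibitions that are still possible. -/
noncomputable def events (s : Config V E) : ℕ :=
  open Classical in (Finset.univ.filter fun a => a ∈ s.cur (M.owner a)).card +
    (Finset.univ.filter fun e => s.res (.inl e) ≠ 0).card

/-- There are two moves per edge and one closing per edge. -/
theorem events_le (s : Config V E) : M.events s ≤ 3 * Fintype.card E := by
  classical
  have h1 := Finset.card_le_univ (Finset.univ.filter fun a => a ∈ s.cur (M.owner a))
  have h2 := Finset.card_le_univ (Finset.univ.filter fun e => s.res (.inl e) ≠ 0)
  rw [Fintype.card_sum] at h1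
  unfold events
  convert (add_le_add h1 h2).trans (by omega : _ ≤ 3 * Fintype.card E)

theorem events_push_le {a : E ⊕ E} {δ : ℝ} (h0 : 0 ≤ δ) (hδ : δ ≤ s.res a) :
    M.events (s.push a δ) ≤ M.events s := by
  classical
  refine add_le_add le_rfl (Finset.card_le_card ?_)
  intro e
  simp only [Finset.mem_filter, Finset.mem_univ, true_and]
  exact mt (res_inl_push_eq_zero h0 hδ)

theorem events_close_lt {e : E} (he : s.res (.inl e) ≠ 0) : M.events (s.close e) < M.events s := by
  classical
  refine add_lt_add_of_le_of_lt le_rfl (Finset.card_lt_card ?_)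
  refine Finset.ssubset_iff.2 ⟨e, by simp [Config.close], ?_⟩
  intro e'
  simp only [Finset.mem_insert, Finset.mem_filter, Finset.mem_univ, true_and]
  rintro (rfl | h)
  · exact he
  · intro h'
    by_cases hee : e' = e
    · exact he (hee ▸ h')
    · simp [Config.close, hee, h'] at h

theorem Inv.events_advance_lt (hs : M.Inv s) {x : V} {a : E ⊕ E} (ha : M.Ready s x a) :
    M.events (s.advance x) < M.events s := by
  classical
  obtain ⟨l, hl⟩ := ha.cur_eq
  have hown := ha.owner_eq hs
  refine add_lt_add_of_lt_of_le (Finset.card_lt_card ?_) le_rfl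
  refine Finset.ssubset_iff.2 ⟨a, ?_, ?_⟩
  · simp [hown, Config.advance, hl, hs.notMem_tail ha.internal hl]
  · intro b
    simp only [Finset.mem_insert, Finset.mem_filter, Finset.mem_univ, true_and]
    rintro (rfl | h)
    · simp [hown, hl]
    · exact (cur_advance_suffix s x _).subset h

theorem active_push {a : E ⊕ E} {δ : ℝ} (h0 : 0 ≤ δ) {v : V} (h : M.Active (s.push a δ) v) :
    M.Active s v ∨ v = M.target a := by
  classical
  by_contra! hc
  refine hc.1 ⟨h.1, ?_⟩
  have h2 : M.lev s v < _ := h.2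
  rw [ex_push, if_neg hc.2] at h2
  split_ifs at h2 <;> linarith

/-- After handing on its whole surplus, `x` can be active only if it is itself the target. -/
theorem active_push_of_eq {x : V} {a : E ⊕ E} (hx : M.owner a = x)
    {v : V} (h : M.Active (s.push a (M.ex s x - M.lev s x)) v) :
    (M.Active s v ∧ v ≠ x) ∨ v = M.target a := by
  classical
  by_contra! hc
  have h2 : M.lev s v < _ := h.2
  by_cases hv : M.target a = v
  · exact hc.2 hv.symm
  rw [ex_push, if_neg hc.2, hx] at h2
  by_cases hvx : v = x
  · subst hvx
    rw [if_pos rfl] at h2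
    linarith
  · rw [if_neg hvx] at h2
    exact hvx (hc.1 ⟨h.1, by linarith⟩)

theorem active_close {e : E} {v : V} (h : M.Active (s.close e) v) : M.Active s v := by
  refine ⟨h.1, ?_⟩
  have := h.2
  rwa [ex, s.flow_close e] at this

theorem Inv.active_advance (hs : M.Inv s) {x : V} (hx : M.internal x) {v : V}
    (h : M.Active (s.advance x) v) : M.Active s v :=
  ⟨h.1, (hs.lev_le_advance hx v).trans_lt h.2⟩

section

variable [Fintype V]

variable (M) in
/-- The vertices that have to make a move. -/
noncomputable def activeSet (s : Config V E) : Finset V :=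
  open Classical in Finset.univ.filter (M.Active s)

theorem mem_activeSet {v : V} : v ∈ M.activeSet s ↔ M.Active s v := by
  simp [activeSet]

/-- An active vertex owns a move, and there are `2m` moves. A bound by `n` would not do, since the
number of phases must be `O(m)`. -/
theorem Inv.card_activeSet_le (hs : M.Inv s) : (M.activeSet s).card ≤ 2 * Fintype.card E := by
  classical
  have h : M.activeSet s ⊆ Finset.univ.image M.owner := by
    intro v hv
    rw [mem_activeSet] at hv
    obtain ⟨a, l, hl⟩ := hv.exists_cons hs
    exact Finset.mem_image.2 ⟨a, Finset.mem_univ _,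
      M.mem_full.1 ((hs.suffix v hv.1).subset (by simp [hl]))⟩
  refine (Finset.card_le_card h).trans (Finset.card_image_le.trans ?_)
  rw [Finset.card_univ, Fintype.card_sum]
  omega

end

/-! ### Rotations -/

/-- A cycle of vertices each of which sends its excess to the next one. -/
structure Cycle (M : Market V E) (s : Config V E) (k : ℕ) (w : ℕ → V) (A : ℕ → E ⊕ E) : Prop where
  pos : 0 < k
  ready : ∀ j < k, M.Ready s (w j) (A j)
  lev_le : ∀ j < k, M.lev s (w j) ≤ M.ex s (w j)
  next : ∀ j < k, w (j + 1) = M.target (A j)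
  closed : w k = w 0
  inj : ∀ i < k, ∀ j < k, w i = w j → i = j

/-- In `s'`, the amount `δ` has been taken from the vertex `w 0` and brought to the vertex `w i`. -/
structure Rotated (M : Market V E) (s : Config V E) (k : ℕ) (w : ℕ → V) (A : ℕ → E ⊕ E) (δ : ℝ)
    (i : ℕ) (s' : Config V E) : Prop where
  inv : M.Inv s'
  cur_eq : s'.cur = s.cur
  ex_eq : ∀ v, M.ex s' v =
    M.ex s v - (open Classical in if v = w 0 then δ else 0) +
      (open Classical in if v = w i then δ else 0)
  ready : ∀ j < k, M.Ready s' (w j) (A j)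
  res_lt : ∀ j < k, j < i → s'.res (A j) = s.res (A j) - δ
  res_ge : ∀ j < k, i ≤ j → s'.res (A j) = s.res (A j)
  events_le : M.events s' ≤ M.events s
  of_closed : ∀ e, M.Closed s' e → M.Closed s e ∨ ∃ j < k, M.head e = w j

theorem Cycle.rotated_zero (hs : M.Inv s) {k : ℕ} {w : ℕ → V} {A : ℕ → E ⊕ E}
    (h : Cycle M s k w A) (δ : ℝ) : Rotated M s k w A δ 0 s where
  inv := hs
  cur_eq := rfl
  ex_eq v := by split_ifs <;> ring
  ready := h.ready
  res_lt := by simp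
  res_ge _ _ _ := rfl
  events_le := le_rfl
  of_closed _ h := .inl h

/-- The owners on the cycle are distinct, so each residual on the cycle is lowered by its own push
alone. -/
theorem Rotated.push {k : ℕ} {w : ℕ → V} {A : ℕ → E ⊕ E} {δ : ℝ} {i : ℕ} {s' : Config V E}
    (h : Rotated M s k w A δ i s') (hc : Cycle M s k w A) (hi : i < k) (h0 : 0 ≤ δ)
    (hδ : ∀ j < k, δ ≤ s.res (A j)) : Rotated M s k w A δ (i + 1) (s'.push (A i) δ) := by
  classical
  have hle : δ ≤ s'.res (A i) := by rw [h.res_ge i hi le_rfl]; exact hδ i hi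
  have hown := fun j hj => (h.ready j hj).owner_eq h.inv
  have hres : ∀ j < k, j ≠ i → (s'.push (A i) δ).res (A j) = s'.res (A j) := by
    intro j hj hji
    have hne : A j ≠ A i := by
      intro hA
      exact hji (hc.inj j hj i hi (by rw [← hown j hj, ← hown i hi, hA]))
    -- If the cycle both increases and decreases `e`, then readiness of the decrease forces residual
    -- 0 for the increase, so `δ = 0` and nothing changes.
    by_cases hx : ∃ e, A i = .inl e ∧ A j = .inr e
    · obtain ⟨e, he1, he2⟩ := hx
      have h1 := (h.ready j hj).res_eq_zero e he2
      have h2 : δ = 0 := by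
        rw [he1] at hle
        linarith
      subst h2
      rw [he1, he2]
      simp [Config.push]
    · refine res_push_of_ne _ hne (fun e he1 he2 => hx ⟨e, he1, he2⟩) δ
  refine ⟨h.inv.push (h.ready i hi) h0 hle, h.cur_eq, ?_, ?_, ?_, ?_, ?_, ?_⟩
  · intro v
    rw [ex_push, h.ex_eq, hown i hi, ← hc.next i hi]
    ring
  · exact fun j hj => (h.ready j hj).push h0 hle
  · intro j hj hji
    by_cases hji' : j = i
    · subst hji'
      rw [res_push_self, h.res_ge j hj le_rfl]
    · rw [hres j hj hji', h.res_lt j hj (by omega)]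
  · intro j hj hji
    rw [hres j hj (by omega), h.res_ge j hj (by omega)]
  · exact (events_push_le h0 hle).trans h.events_le
  · intro e he
    rcases h.inv.closed_push (h.ready i hi) he with h1 | h1
    · exact h.of_closed e h1
    · exact .inr ⟨i, hi, h1⟩

theorem Rotated.ex_eq_of_cycle {k : ℕ} {w : ℕ → V} {A : ℕ → E ⊕ E} {δ : ℝ} {s' : Config V E}
    (h : Rotated M s k w A δ k s') (hc : Cycle M s k w A) (v : V) : M.ex s' v = M.ex s v := by
  rw [h.ex_eq, hc.closed]
  ring

/-- A full rotation changes no excess; an edge closed by it has its head on the cycle, where the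
excess is at least the level, which is `high` there. -/
theorem Rotated.lowerBound {k : ℕ} {w : ℕ → V} {A : ℕ → E ⊕ E} {δ : ℝ} {s' : Config V E}
    (h : Rotated M s k w A δ k s') (hc : Cycle M s k w A) (hs : M.LowerBound s) :
    M.LowerBound s' := by
  constructor
  · intro v hv
    rw [h.ex_eq_of_cycle hc]
    exact hs.low_le v hv
  · intro e he
    rw [h.ex_eq_of_cycle hc]
    rcases h.of_closed e he with h1 | ⟨j, hj, h1⟩
    · exact hs.high_le e h1
    · rw [← lev_of_forall _ (h.inv.exists_inr_cons he), lev_congr h.cur_eq, h1]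
      exact hc.lev_le j hj

theorem Rotated.active_iff {k : ℕ} {w : ℕ → V} {A : ℕ → E ⊕ E} {δ : ℝ} {s' : Config V E}
    (h : Rotated M s k w A δ k s') (hc : Cycle M s k w A) (v : V) :
    M.Active s' v ↔ M.Active s v := by
  rw [Active, Active, h.ex_eq_of_cycle hc, lev_congr h.cur_eq]

/-- A sufficiently long walk ends on a cycle. -/
theorem exists_cycle [Fintype V] {x : V} {k : ℕ} (hk : Fintype.card V ≤ k)
    (h : ∀ j < k, ∃ a, M.Ready s ((succ M s)^[j] x) a ∧
      M.lev s ((succ M s)^[j] x) ≤ M.ex s ((succ M s)^[j] x)) :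
    ∃ l w A, Cycle M s l w A ∧ w 0 = (succ M s)^[k] x ∧ l ≤ Fintype.card V := by
  classical
  set g := succ M s with hg
  -- Pigeonhole: among the first `card V + 1` vertices of the walk one is repeated, and from there
  -- on the walk is periodic.
  obtain ⟨i, j, hij, heq⟩ : ∃ i j : Fin (Fintype.card V + 1), i < j ∧ g^[i] x = g^[j] x := by
    obtain ⟨i, j, hne, h⟩ := Fintype.exists_ne_map_eq_of_card_lt
      (fun i : Fin (Fintype.card V + 1) => g^[(i : ℕ)] x) (by simp)
    rcases lt_or_gt_of_ne hne with h' | h'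
    · exact ⟨i, j, h', h⟩
    · exact ⟨j, i, h', h.symm⟩
  have hij' : (i : ℕ) < j := hij
  have hj := j.2
  obtain ⟨p, hp⟩ : ∃ p, p + (i : ℕ) = j := ⟨j - i, by omega⟩
  have hper : Function.IsPeriodicPt g p (g^[i] x) := by
    rw [Function.IsPeriodicPt, Function.IsFixedPt, ← Function.iterate_add_apply, hp, heq]
  set z := g^[k] x with hz
  have hzper : Function.IsPeriodicPt g p z := by
    have h1 := hper.apply_iterate (k - i)
    rwa [← Function.iterate_add_apply, Nat.sub_add_cancel (by omega)] at h1
  have hppos : 0 < p := by omega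
  have hready : ∀ t, ∃ a, M.Ready s (g^[t] z) a ∧ M.lev s (g^[t] z) ≤ M.ex s (g^[t] z) := by
    intro t
    -- Reduction modulo the period brings every vertex of the cycle to a position before `j`, hence
    -- before `k`, where readiness is known.
    have h1 : g^[t] z = g^[(t + k - i) % p + i] x := by
      rw [hz, ← Function.iterate_add_apply, Function.iterate_add_apply g _ (i : ℕ),
        hper.iterate_mod_apply, ← Function.iterate_add_apply]
      rw [show t + k - (i : ℕ) + i = t + k by omega]
    rw [h1]
    have := Nat.mod_lt (t + k - i) hppos
    exact h _ (by omega)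
  choose A hA using hready
  have hmin := hzper.minimalPeriod_le hppos
  refine ⟨Function.minimalPeriod g z, fun t => g^[t] z, A, ⟨hzper.minimalPeriod_pos hppos,
    fun t _ => (hA t).1, fun t _ => (hA t).2, ?_, ?_, ?_⟩, rfl, by omega⟩
  · intro t _
    rw [Function.iterate_succ_apply', ← (hA t).1.succ_eq]
  · exact Function.isPeriodicPt_minimalPeriod g z
  · intro a ha b hb hab
    exact Function.iterate_injOn_Iio_minimalPeriod (f := g) (x := z) ha hb hab

end Market
/-! ### The program -/

/-- Test whether the vertex in variable `i` has to make a move. -/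
def activeTest (i : ℕ) : Test :=
  .and (.natEq (.arr 0 (.var i)) (.const 0)) (.realLt (.arr 5 (.var i)) (.arr 4 (.var i)))

/-- The number of the move by which the move `a` with `m < a` can be undone. -/
def undoExp : NatExp := .sub (.var 7) (.add (.var 1) (.const 1))

/-- The vertex in variable `i` makes its current move, which is held in variable `7`, by the amount
held in the real variable `0`. -/
def pushProg (i : ℕ) : Prog :=
  .seq (.storeReal 3 (.var 7) (.sub (.arr 3 (.var 7)) (.var 0)))
  (.seq (.ite (.natLt (.var 1) (.var 7))
    (.storeReal 3 undoExp (.add (.arr 3 undoExp) (.var 0))) .skip)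
  (.seq (.storeReal 4 (.var i) (.sub (.arr 4 (.var i)) (.var 0)))
  (.storeReal 4 (.arr 13 (.var 7)) (.add (.arr 4 (.arr 13 (.var 7))) (.var 0)))))

/-- The vertex in variable `i` passes to its next move. -/
def advanceProg (i : ℕ) : Prog :=
  .seq (.storeNat 11 (.var i) (.arr 12 (.arr 11 (.var i))))
  -- Numbers above `m` are increases, which keep the level; a decrease, or no move (number `m`),
  -- sets it to `high`.
  (.ite (.natLt (.var 1) (.arr 11 (.var i))) .skip (.storeReal 5 (.var i) (.arr 2 (.var i))))

/-- The number of the increase of the flow on the edge in variable `7`. -/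
def increaseExp : NatExp := .add (.add (.var 1) (.const 1)) (.var 7)

/-- One action of the vertex in variable `3`. -/
def stepProg : Prog :=
  .seq (.setNat 7 (.arr 11 (.var 3)))
  (.ite (.and (.natLt (.var 7) (.var 1)) (.not (.realEq (.arr 3 increaseExp) .zero)))
    -- The counter value `n + 2` signals an event and ends the walk; without an event the counter is
    -- at most `n + 1`.
    (.seq (.storeReal 3 increaseExp .zero) (.setNat 4 (.add (.var 0) (.const 2))))
    (.ite (.realLt (.arr 3 (.var 7)) (.sub (.arr 4 (.var 3)) (.arr 5 (.var 3))))
      (.seq (.setReal 0 (.arr 3 (.var 7))) (.seq (pushProg 3)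
        (.seq (advanceProg 3) (.setNat 4 (.add (.var 0) (.const 2))))))
      (.seq (.setReal 0 (.sub (.arr 4 (.var 3)) (.arr 5 (.var 3)))) (.seq (pushProg 3)
        (.seq (.setNat 3 (.arr 13 (.var 7))) (.setNat 4 (.add (.var 4) (.const 1))))))))

/-! ### Configurations in memory and the simulation of single actions -/

section Representation

variable {V E : Type*} {n m : ℕ}

/-- The number of a move: the decrease of the flow on an edge has the number of the edge. -/
def moveNum (enum : E ≃ Fin m) : E ⊕ E → ℕ :=
  Sum.elim (fun e => m + 1 + enum e) (fun e => enum e)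

/-- The number of the first move in a list, and `m` if there is none. -/
def firstNum (enum : E ≃ Fin m) (l : List (E ⊕ E)) : ℕ := (l.map (moveNum enum)).headD m

theorem moveNum_injective (enum : E ≃ Fin m) : Function.Injective (moveNum enum) := by
  rintro (e | e) (e' | e') h
  · simp only [moveNum, Sum.elim_inl] at h
    exact congrArg _ (enum.injective (Fin.ext (by omega)))
  · simp only [moveNum, Sum.elim_inl, Sum.elim_inr] at h
    have := (enum e').2
    omega
  · simp only [moveNum, Sum.elim_inl, Sum.elim_inr] at h
    have := (enum e).2
    omega
  · simp only [moveNum, Sum.elim_inr] at h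
    exact congrArg _ (enum.injective (Fin.ext (by omega)))

theorem moveNum_inl (enum : E ≃ Fin m) (e : E) : moveNum enum (.inl e) = m + 1 + enum e := rfl

theorem moveNum_inr (enum : E ≃ Fin m) (e : E) : moveNum enum (.inr e) = enum e := rfl

theorem lt_moveNum_inl (enum : E ≃ Fin m) (e : E) : m < moveNum enum (.inl e) := by
  rw [moveNum_inl]; omega

theorem moveNum_inr_lt (enum : E ≃ Fin m) (e : E) : moveNum enum (.inr e) < m := (enum e).2

theorem moveNum_eq_iff (enum : E ≃ Fin m) {a b : E ⊕ E} :
    moveNum enum a = moveNum enum b ↔ a = b := (moveNum_injective enum).eq_iff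

theorem vnum_eq_iff (vnum : V ≃ Fin n) {v w : V} : (vnum v : ℕ) = vnum w ↔ v = w := by
  rw [← Fin.ext_iff, vnum.injective.eq_iff]

variable [Fintype E] {M : Market V E} {vnum : V ≃ Fin n} {enum : E ≃ Fin m}

/-- The memory `σ` holds the state `s` of the algorithm. -/
structure Rep (M : Market V E) (vnum : V ≃ Fin n) (enum : E ≃ Fin m) (σ : State)
    (s : Config V E) : Prop where
  n_eq : σ.natVar 0 = n
  m_eq : σ.natVar 1 = m
  kind_iff : ∀ v, σ.natArr 0 (vnum v) = 0 ↔ M.internal v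
  high_eq : ∀ v, M.internal v → σ.realArr 2 (vnum v) = M.high v
  cur_eq : ∀ v, M.internal v → σ.natArr 11 (vnum v) = firstNum enum (s.cur v)
  next_eq : ∀ v, M.internal v → ∀ a l, a :: l <:+ M.full v →
    σ.natArr 12 (moveNum enum a) = firstNum enum l
  target_eq : ∀ a, σ.natArr 13 (moveNum enum a) = vnum (M.target a)
  res_eq : ∀ a, σ.realArr 3 (moveNum enum a) = s.res a
  ex_eq : ∀ v, σ.realArr 4 (vnum v) = M.ex s v
  lev_eq : ∀ v, M.internal v → σ.realArr 5 (vnum v) = M.lev s v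

variable {σ τ : State} {s : Config V E}

theorem Rep.congr (h : Rep M vnum enum σ s) (h0 : τ.natVar 0 = σ.natVar 0)
    (h1 : τ.natVar 1 = σ.natVar 1) (h2 : τ.natArr = σ.natArr) (h3 : τ.realArr = σ.realArr) :
    Rep M vnum enum τ s := by
  obtain ⟨a1, a2, a3, a4, a5, a6, a7, a8, a9, a10⟩ := h
  constructor <;> simpa only [h0, h1, h2, h3]

theorem Rep.activeTest_iff (h : Rep M vnum enum σ s) {i : ℕ} {x : V} (hi : σ.natVar i = vnum x) :
    (activeTest i).Holds σ ↔ M.Active s x := by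
  simp only [activeTest, Test.Holds, NatExp.eval, RealExp.eval, hi, h.kind_iff, h.ex_eq]
  refine and_congr_right fun hx => ?_
  rw [h.lev_eq x hx]

/-- Memory contents that differ at most in the arrays. -/
def SameVars (σ τ : State) : Prop := τ.natVar = σ.natVar ∧ τ.realVar = σ.realVar

theorem den_pushProg (σ : State) (i : ℕ) : (pushProg i).den σ =
    let a := σ.natVar 7
    let f := Function.update (σ.realArr 3) a (σ.realArr 3 a - σ.realVar 0)
    let b := a - (σ.natVar 1 + 1)
    let g := Function.update (σ.realArr 4) (σ.natVar i) (σ.realArr 4 (σ.natVar i) - σ.realVar 0)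
    let t := σ.natArr 13 a
    { σ with
      realArr := Function.update (Function.update σ.realArr 3
        (if σ.natVar 1 < a then Function.update f b (f b + σ.realVar 0) else f)) 4
        (Function.update g t (g t + σ.realVar 0)) } := by
  by_cases h : σ.natVar 1 < σ.natVar 7 <;>
    simp [pushProg, Prog.den, State.storeReal, NatExp.eval, RealExp.eval, Test.Holds, undoExp, h]

theorem Rep.push (h : Rep M vnum enum σ s) {i : ℕ} {a : E ⊕ E} (hi : σ.natVar i = vnum (M.owner a))
    (ha : σ.natVar 7 = moveNum enum a) :
    Rep M vnum enum ((pushProg i).den σ) (s.push a (σ.realVar 0)) ∧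
      SameVars σ ((pushProg i).den σ) := by
  classical
  rw [den_pushProg]
  refine ⟨⟨h.n_eq, h.m_eq, h.kind_iff, ?_, h.cur_eq, h.next_eq, h.target_eq, ?_, ?_, ?_⟩, rfl, rfl⟩
  · simpa using h.high_eq
  · intro b
    have e1 := h.res_eq
    cases a with
    | inl e =>
      have hlt := lt_moveNum_inl enum e
      -- The decrease undoing an increase has the number of the edge itself, so an increase also
      -- updates the flow cell.
      have hu : moveNum enum (.inl e) - (m + 1) = moveNum enum (.inr e) := by
        rw [moveNum_inl, moveNum_inr]; omega
      simp [h.m_eq, Function.update_apply, Config.push, ha, hlt, hu, moveNum_eq_iff, e1]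
    | inr e =>
      have hlt := (moveNum_inr_lt enum e).not_gt
      simp [h.m_eq, Function.update_apply, Config.push, ha, hlt, moveNum_eq_iff, e1]
  · intro v
    rw [Market.ex_push]
    simp only [Function.update_self, ha, h.target_eq, hi, Function.update_apply, vnum_eq_iff,
      h.ex_eq]
    by_cases hv : v = M.target a
    · subst hv
      -- Loops are not excluded in a `Market`: then both writes hit the same cell and cancel.
      by_cases hw : M.target a = M.owner a <;> simp [hw]
    · by_cases hw : v = M.owner a
      · subst hw
        simp [hv]
      · simp [hv, hw]
  · intro v hv
    rw [show M.lev (s.push a (σ.realVar 0)) v = M.lev s v from rfl]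
    simpa using h.lev_eq v hv

theorem Rep.close (h : Rep M vnum enum σ s) {e : E} {k : ℕ} (hk : k = moveNum enum (.inl e)) :
    Rep M vnum enum (σ.storeReal 3 k 0) (s.close e) := by
  classical
  subst hk
  refine ⟨h.n_eq, h.m_eq, h.kind_iff, ?_, h.cur_eq, h.next_eq, h.target_eq, ?_, ?_, ?_⟩
  · simpa [State.storeReal] using h.high_eq
  · intro b
    simp [State.storeReal, Config.close, Function.update_apply, moveNum_eq_iff, h.res_eq]
  · intro v
    rw [Market.ex, s.flow_close]
    simpa [State.storeReal] using h.ex_eq v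
  · intro v hv
    rw [show M.lev (s.close e) v = M.lev s v from rfl]
    simpa [State.storeReal] using h.lev_eq v hv

theorem den_advanceProg (σ : State) (i : ℕ) : (advanceProg i).den σ =
    let x := σ.natVar i
    let k := σ.natArr 12 (σ.natArr 11 x)
    { σ with
      natArr := Function.update σ.natArr 11 (Function.update (σ.natArr 11) x k)
      realArr := Function.update σ.realArr 5 (if σ.natVar 1 < k then σ.realArr 5 else
        Function.update (σ.realArr 5) x (σ.realArr 2 x)) } := by
  by_cases h : σ.natVar 1 < σ.natArr 12 (σ.natArr 11 (σ.natVar i)) <;>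
    simp [advanceProg, Prog.den, State.storeReal, State.storeNat, NatExp.eval, RealExp.eval,
      Test.Holds, h]

theorem Rep.advance (h : Rep M vnum enum σ s) (hs : M.Inv s) {i : ℕ} {x : V} {a : E ⊕ E}
    (ha : M.Ready s x a) (hi : σ.natVar i = vnum x) :
    Rep M vnum enum ((advanceProg i).den σ) (s.advance x) ∧
      SameVars σ ((advanceProg i).den σ) := by
  classical
  obtain ⟨l, hl⟩ := ha.cur_eq
  have hx := ha.internal
  have hsuf := hl ▸ hs.suffix x hx
  have hnext := h.next_eq x hx a l hsuf
  have hcx : (s.advance x).cur x = l := by simp [Config.advance, hl]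
  have hcur : σ.natArr 11 (vnum x) = moveNum enum a := by
    rw [h.cur_eq x hx, hl]; rfl
  rw [den_advanceProg]
  refine ⟨⟨h.n_eq, h.m_eq, ?_, ?_, ?_, ?_, ?_, ?_, ?_, ?_⟩, rfl, rfl⟩
  · simpa using h.kind_iff
  · simpa using h.high_eq
  · intro v hv
    by_cases hvx : v = x
    · subst hvx
      simp [hi, hcur, hnext, hcx]
    · simpa [hi, Function.update_apply, vnum_eq_iff, Config.advance, hvx] using h.cur_eq v hv
  · simpa using h.next_eq
  · simpa using h.target_eq
  · intro b
    refine Eq.trans ?_ (h.res_eq b)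
    simp
  · intro v
    refine Eq.trans ?_ (h.ex_eq v)
    simp
  · intro v hv
    have hlev := h.lev_eq v hv
    by_cases hvx : v = x
    · subst hvx
      -- The stored level is kept exactly if an increase follows; then `a` was an increase as well,
      -- and the level was already `-low`.
      cases l with
      | nil => simp [hi, hcur, hnext, firstNum, h.m_eq, Market.lev, hcx, h.high_eq v hx]
      | cons b l =>
        cases b with
        | inl e =>
          have hlt := lt_moveNum_inl enum e
          have h1 : M.lev s v = -M.low v := by
            cases a with
            | inl e' => simp [Market.lev, hl]
            | inr e' =>
              obtain ⟨_, h'⟩ := M.eq_inr_of_mem hsuf (a := .inl e) (by simp)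
              simp at h'
          have h2 : M.lev (s.advance v) v = -M.low v := by simp [Market.lev, hcx]
          simp [hi, hcur, hnext, firstNum, h.m_eq, hlt, hlev, h1, h2]
        | inr e =>
          have hlt := (moveNum_inr_lt enum e).not_gt
          simp [hi, hcur, hnext, firstNum, h.m_eq, Market.lev, hcx, hlt, h.high_eq v hx]
    · have : M.lev (s.advance x) v = M.lev s v := by simp [Market.lev, Config.advance, hvx]
      rw [this, ← hlev]
      simp only [Function.update_self]
      split_ifs
      · rfl
      · rw [Function.update_of_ne]
        rwa [hi, Ne, vnum_eq_iff]

end Representation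
-- One step of a walk
section Walk

variable {V E : Type*} [Fintype V] [Fintype E] {n m : ℕ} {M : Market V E} {vnum : V ≃ Fin n}
  {enum : E ≃ Fin m} {σ τ : State} {s : Config V E}

/-- The result of an action that makes progress. -/
def Progress (M : Market V E) (s s' : Config V E) (x : V) : Prop :=
  M.events s' < M.events s ∧
    (M.activeSet s').card ≤ (open Classical in (M.activeSet s).erase x).card + 2

/-- The result of an action that only moves excess from `x` to `y`. -/
structure Moved (M : Market V E) (s s' : Config V E) (x y : V) : Prop where
  exists_ready : ∃ a, M.Ready s x a ∧ y = M.target a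
  cur_eq : s'.cur = s.cur
  events_le : M.events s' ≤ M.events s
  erase_subset : (open Classical in (M.activeSet s').erase y) ⊆
    (open Classical in (M.activeSet s).erase x)
  ready : ∀ v b, M.Ready s v b → M.Ready s' v b
  -- The vertex `x` is left at or above its level, and no other vertex loses excess.
  lev_le : ∀ v, v = x ∨ M.lev s v ≤ M.ex s v → M.lev s' v ≤ M.ex s' v

/-- Three cases: the edge to be decreased must first be closed (an event); the residual is less than
the surplus, so the move is exhausted and abandoned (an event); or the whole surplus passes to the
target, where the walk continues. -/
theorem Rep.step (h : Rep M vnum enum σ s) (hs : M.Inv s) (hb : M.LowerBound s) {x : V}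
    (hx : M.Active s x) (h3 : σ.natVar 3 = vnum x) :
    ∃ s', Rep M vnum enum (stepProg.den σ) s' ∧ M.Inv s' ∧ M.LowerBound s' ∧
      (((stepProg.den σ).natVar 4 = n + 2 ∧ Progress M s s' x) ∨
        ∃ y, (stepProg.den σ).natVar 3 = vnum y ∧ (stepProg.den σ).natVar 4 = σ.natVar 4 + 1 ∧
          Moved M s s' x y) := by
  classical
  obtain ⟨a, l, hl⟩ := hx.exists_cons hs
  have hxi := hx.1
  have hown : M.owner a = x := M.mem_full.1 ((hs.suffix x hxi).subset (by simp [hl]))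
  have hcur : σ.natArr 11 (vnum x) = moveNum enum a := by
    rw [h.cur_eq x hxi, hl]; rfl
  have hcard : (M.activeSet s).card = ((M.activeSet s).erase x).card + 1 :=
    (Finset.card_erase_add_one (Market.mem_activeSet.2 hx)).symm
  set σ₁ := σ.setNat 7 (moveNum enum a) with hσ₁
  have h₁ : Rep M vnum enum σ₁ s := h.congr rfl rfl rfl rfl
  have h₁3 : σ₁.natVar 3 = vnum x := h3
  have h₁7 : σ₁.natVar 7 = moveNum enum a := by simp [hσ₁, State.setNat]
  have hden0 : (Prog.setNat 7 (.arr 11 (.var 3))).den σ = σ₁ := by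
    simp [Prog.den, NatExp.eval, h3, hcur, hσ₁]
  have hsur : σ₁.realArr 4 (vnum x) - σ₁.realArr 5 (vnum x) = M.ex s x - M.lev s x := by
    rw [h₁.ex_eq, h₁.lev_eq x hxi]
  by_cases hc : ∃ e, a = .inr e ∧ s.res (.inl e) ≠ 0
  · obtain ⟨e, rfl, he⟩ := hc
    have hinc : increaseExp.eval σ₁ = moveNum enum (.inl e) := by
      simp [increaseExp, NatExp.eval, h₁7, h₁.m_eq, moveNum_inl, moveNum_inr]
    have htest : (Test.and (.natLt (.var 7) (.var 1))
        (.not (.realEq (.arr 3 increaseExp) .zero))).Holds σ₁ := by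
      refine ⟨?_, ?_⟩
      · simpa [Test.Holds, NatExp.eval, h₁7, h₁.m_eq] using moveNum_inr_lt enum e
      · simp only [Test.Holds, RealExp.eval, hinc, h₁.res_eq]
        exact he
    have hden : stepProg.den σ =
        (σ₁.storeReal 3 (moveNum enum (.inl e)) 0).setNat 4 (n + 2) := by
      rw [stepProg, Prog.den, hden0, Prog.den, if_pos htest]
      simp only [Prog.den, hinc, RealExp.eval, NatExp.eval]
      congr 1
      exact congrArg (· + 2) h₁.n_eq
    rw [hden]
    refine ⟨s.close e, (h₁.close rfl).congr rfl rfl rfl rfl, hs.close hxi hl, hb.close hs hx hl,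
      .inl ⟨by simp [State.setNat], Market.events_close_lt he, ?_⟩⟩
    have : M.activeSet (s.close e) ⊆ M.activeSet s := fun v hv =>
      Market.mem_activeSet.2 (Market.active_close (Market.mem_activeSet.1 hv))
    have := Finset.card_le_card this
    omega
  have hready : M.Ready s x a := ⟨hxi, ⟨l, hl⟩, fun e he => by
    by_contra h'
    exact hc ⟨e, he, h'⟩⟩
  have htest : ¬ (Test.and (.natLt (.var 7) (.var 1))
      (.not (.realEq (.arr 3 increaseExp) .zero))).Holds σ₁ := by
    rintro ⟨t1, t2⟩
    cases a with
    | inl e =>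
      simp only [Test.Holds, NatExp.eval, h₁7, h₁.m_eq] at t1
      exact absurd t1 (lt_moveNum_inl enum e).not_gt
    | inr e =>
      have hinc : increaseExp.eval σ₁ = moveNum enum (.inl e) := by
        simp [increaseExp, NatExp.eval, h₁7, h₁.m_eq, moveNum_inl, moveNum_inr]
      simp only [Test.Holds, RealExp.eval, hinc, h₁.res_eq] at t2
      exact hc ⟨e, rfl, t2⟩
  have hpos : 0 < M.ex s x - M.lev s x := sub_pos.2 hx.2
  by_cases hlt : s.res a < M.ex s x - M.lev s x
  · have htest2 : (Test.realLt (.arr 3 (.var 7))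
        (.sub (.arr 4 (.var 3)) (.arr 5 (.var 3)))).Holds σ₁ := by
      simp only [Test.Holds, RealExp.eval, NatExp.eval, h₁7, h₁3, h₁.res_eq, hsur]
      exact hlt
    set σ₂ := σ₁.setReal 0 (s.res a) with hσ₂
    have h₂ : Rep M vnum enum σ₂ s := h₁.congr rfl rfl rfl rfl
    have h₂0 : σ₂.realVar 0 = s.res a := by simp [hσ₂, State.setReal]
    obtain ⟨h₃, e1, -⟩ := h₂.push (i := 3) (a := a) (by rw [hown]; exact h₁3) h₁7
    rw [h₂0] at h₃
    have h0 := hs.nonneg a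
    have hready' := hready.push h0 le_rfl
    have hs₃ := hs.push hready h0 le_rfl
    obtain ⟨h₄, e2, -⟩ := h₃.advance hs₃ hready' (i := 3) (by rw [e1]; exact h₁3)
    have hden : stepProg.den σ =
        ((advanceProg 3).den ((pushProg 3).den σ₂)).setNat 4 (n + 2) := by
      rw [stepProg, Prog.den, hden0, Prog.den, if_neg htest, Prog.den, if_pos htest2]
      have : (Prog.setReal 0 (.arr 3 (.var 7))).den σ₁ = σ₂ := by
        simp [Prog.den, NatExp.eval, RealExp.eval, h₁7, h₁.res_eq, hσ₂]
      simp only [Prog.den, NatExp.eval] at this ⊢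
      rw [this]
      congr 1
      exact congrArg (· + 2) h₄.n_eq
    rw [hden]
    have hz : (s.push a (s.res a)).res a = 0 := by rw [Market.res_push_self, sub_self]
    refine ⟨_, h₄.congr rfl rfl rfl rfl, hs₃.advance hready' hz,
      (hb.push hs hready h0 le_rfl hlt.le).advance x, .inl ⟨by simp [State.setNat], ?_, ?_⟩⟩
    · exact (hs₃.events_advance_lt hready').trans_le (Market.events_push_le h0 le_rfl)
    -- Only the target can become active; together with `x`, which may stay active, this gives the
    -- `2` in `Progress`.
    · have : M.activeSet ((s.push a (s.res a)).advance x) ⊆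
          insert (M.target a) (M.activeSet s) := by
        intro v hv
        rw [Market.mem_activeSet] at hv
        rw [Finset.mem_insert, Market.mem_activeSet]
        exact (Market.active_push h0 (hs₃.active_advance hxi hv)).symm
      have := (Finset.card_le_card this).trans (Finset.card_insert_le _ _)
      omega
  · have htest2 : ¬ (Test.realLt (.arr 3 (.var 7))
        (.sub (.arr 4 (.var 3)) (.arr 5 (.var 3)))).Holds σ₁ := by
      simp only [Test.Holds, RealExp.eval, NatExp.eval, h₁7, h₁3, h₁.res_eq, hsur]
      exact hlt
    rw [not_lt] at hlt
    set δ := M.ex s x - M.lev s x with hδ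
    set σ₂ := σ₁.setReal 0 δ with hσ₂
    have h₂ : Rep M vnum enum σ₂ s := h₁.congr rfl rfl rfl rfl
    have h₂0 : σ₂.realVar 0 = δ := by simp [hσ₂, State.setReal]
    obtain ⟨h₃, e1, -⟩ := h₂.push (i := 3) (a := a) (by rw [hown]; exact h₁3) h₁7
    rw [h₂0] at h₃
    have hden : stepProg.den σ =
        (((pushProg 3).den σ₂).setNat 3 (vnum (M.target a))).setNat 4 (σ.natVar 4 + 1) := by
      rw [stepProg, Prog.den, hden0, Prog.den, if_neg htest, Prog.den, if_neg htest2]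
      have : (Prog.setReal 0 (.sub (.arr 4 (.var 3)) (.arr 5 (.var 3)))).den σ₁ = σ₂ := by
        simp only [Prog.den, NatExp.eval, RealExp.eval, h₁3, hσ₂, hsur]
      simp only [Prog.den, NatExp.eval] at this ⊢
      rw [this, e1]
      have e3 : σ₂.natVar 7 = moveNum enum a := h₁7
      rw [e3, h₃.target_eq]
      simp only [State.setNat, e1]
      rfl
    rw [hden]
    refine ⟨_, h₃.congr rfl rfl rfl rfl, hs.push hready hpos.le hlt,
      hb.push hs hready hpos.le hlt le_rfl, .inr ⟨M.target a, by simp [State.setNat],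
      by simp [State.setNat], ⟨a, hready, rfl⟩, rfl, Market.events_push_le hpos.le hlt, ?_,
      fun v b hv => hv.push hpos.le hlt, ?_⟩⟩
    · intro v hv
      rw [Finset.mem_erase, Market.mem_activeSet] at hv ⊢
      rcases Market.active_push_of_eq hown hv.2 with h' | h'
      · exact h'.symm
      · exact absurd h' hv.1
    · intro v hv
      rw [Market.ex_push, hown, show M.lev (s.push a δ) v = M.lev s v from rfl]
      by_cases hvx : v = x
      · subst hvx
        rw [if_pos rfl]
        split_ifs <;> linarith
      · have := hv.resolve_left hvx
        rw [if_neg hvx]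
        split_ifs <;> linarith

end Walk
/-! ### Walks and rotations -/

/-- Test whether the walk goes on. -/
def walkTest : Test := .and (.not (.natLt (.var 0) (.var 4))) (activeTest 3)

/-- Let the vertex in variable `5` be followed by the next one on its cycle, and find the least
possible amount of a move. -/
def minProg : Prog :=
  .seq (.setNat 7 (.arr 11 (.var 5)))
  (.seq (.ite (.realLt (.arr 3 (.var 7)) (.var 0))
    (.seq (.setReal 0 (.arr 3 (.var 7))) (.setNat 6 (.var 5))) .skip)
  (.setNat 5 (.arr 13 (.var 7))))

/-- The vertex in variable `i` makes its current move, and variable `5` gets the next vertex. -/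
def passProg (i : ℕ) : Prog :=
  .seq (.setNat 7 (.arr 11 (.var i))) (.seq (pushProg i) (.setNat 5 (.arr 13 (.var 7))))

/-- Test whether the cycle has not yet been closed. -/
def cycleTest : Test := .not (.natEq (.var 5) (.var 3))

/-- Initialize the search for the least possible amount of a move on the cycle. -/
def minInitProg : Prog :=
  .seq (.setNat 6 (.var 3)) (.seq (.setNat 7 (.arr 11 (.var 3)))
  (.seq (.setReal 0 (.arr 3 (.var 7))) (.setNat 5 (.arr 13 (.var 7)))))

/-- Move as much as possible round the cycle through the vertex in variable `3`. -/
def rotateProg : Prog :=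
  .seq minInitProg
  (.seq (.while cycleTest minProg)
  (.seq (passProg 3)
  (.seq (.while cycleTest (passProg 5))
  (advanceProg 6))))

/-- Make progress, beginning at the vertex in variable `2`. -/
def phaseProg : Prog :=
  .seq (.seq (.setNat 3 (.var 2)) (.setNat 4 (.const 0)))
  (.seq (.while walkTest stepProg)
  (.ite (.and (.natEq (.var 4) (.add (.var 0) (.const 1))) (activeTest 3)) rotateProg .skip))

/-! ### The least residual on a cycle and the rotation by it -/

section Walk

variable {V E : Type*} [Fintype E] {n m : ℕ} {M : Market V E} {vnum : V ≃ Fin n}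
  {enum : E ≃ Fin m} {σ τ : State} {s s' : Config V E} {k : ℕ} {w : ℕ → V} {A : ℕ → E ⊕ E}

theorem Rep.cur_of_ready (h : Rep M vnum enum σ s) {x : V} {a : E ⊕ E} (ha : M.Ready s x a) :
    σ.natArr 11 (vnum x) = moveNum enum a := by
  obtain ⟨l, hl⟩ := ha.cur_eq
  rw [h.cur_eq x ha.internal, hl]
  rfl

theorem Rep.pass (h : Rep M vnum enum σ s) {i : ℕ} (hi7 : i ≠ 7) {x : V} {a : E ⊕ E}
    (hs : M.Inv s) (ha : M.Ready s x a) (hi : σ.natVar i = vnum x) :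
    Rep M vnum enum ((passProg i).den σ) (s.push a (σ.realVar 0)) ∧
      ((passProg i).den σ).natVar 5 = vnum (M.target a) ∧
      ((passProg i).den σ).natVar 3 = σ.natVar 3 ∧ ((passProg i).den σ).natVar 6 = σ.natVar 6 ∧
      ((passProg i).den σ).realVar = σ.realVar := by
  have hcur := h.cur_of_ready ha
  set σ₁ := σ.setNat 7 (moveNum enum a) with hσ₁
  have h₁ : Rep M vnum enum σ₁ s := h.congr rfl rfl rfl rfl
  have h₁7 : σ₁.natVar 7 = moveNum enum a := by simp [hσ₁, State.setNat]
  have h₁i : σ₁.natVar i = vnum x := by simp [hσ₁, State.setNat, hi7, hi]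
  obtain ⟨h₂, e1, e2⟩ := h₁.push (i := i) (a := a) (by rw [ha.owner_eq hs]; exact h₁i) h₁7
  have hden : (passProg i).den σ = ((pushProg i).den σ₁).setNat 5 (vnum (M.target a)) := by
    have : (Prog.setNat 7 (.arr 11 (.var i))).den σ = σ₁ := by
      simp [Prog.den, NatExp.eval, hi, hcur, hσ₁]
    rw [passProg, Prog.den, this]
    simp only [Prog.den, NatExp.eval, e1, h₁7, h₂.target_eq]
  rw [hden]
  refine ⟨h₂.congr rfl rfl rfl rfl, by simp [State.setNat], ?_, ?_, ?_⟩
  · simp only [State.setNat, e1]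
    simp [State.setNat, hσ₁]
  · simp only [State.setNat, e1]
    simp [State.setNat, hσ₁]
  · simpa [State.setNat, hσ₁] using e2

/-- The state of the search for the least possible amount of a move on a cycle. -/
structure Searched (M : Market V E) (vnum : V ≃ Fin n) (enum : E ≃ Fin m) (s : Config V E)
    (k : ℕ) (w : ℕ → V) (A : ℕ → E ⊕ E) (i : ℕ) (σ : State) : Prop where
  rep : Rep M vnum enum σ s
  start_eq : σ.natVar 3 = vnum (w 0)
  pos_eq : σ.natVar 5 = vnum (w i)
  pos : 0 < i
  le : i ≤ k
  exists_min : ∃ y < k, σ.natVar 6 = vnum (w y) ∧ σ.realVar 0 = s.res (A y)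
  min_le : ∀ j < i, σ.realVar 0 ≤ s.res (A j)

theorem Rep.searched_one (h : Rep M vnum enum σ s) (hc : Market.Cycle M s k w A)
    (h3 : σ.natVar 3 = vnum (w 0)) :
    Searched M vnum enum s k w A 1 (minInitProg.den σ) := by
  have hcur := h.cur_of_ready (hc.ready 0 hc.pos)
  have hden : minInitProg.den σ = ((((σ.setNat 6 (vnum (w 0))).setNat 7
      (moveNum enum (A 0))).setReal 0 (s.res (A 0))).setNat 5 (vnum (w 1))) := by
    rw [hc.next 0 hc.pos]
    simp [minInitProg, Prog.den, NatExp.eval, RealExp.eval, State.setNat, State.setReal, h3, hcur,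
      h.res_eq, h.target_eq]
  rw [hden]
  refine ⟨h.congr rfl rfl rfl rfl, ?_, ?_, one_pos, hc.pos, ⟨0, hc.pos, ?_, ?_⟩, ?_⟩
  · simp [State.setNat, State.setReal, h3]
  · simp [State.setNat, State.setReal]
  · simp [State.setNat, State.setReal]
  · simp [State.setNat, State.setReal]
  · intro j hj
    obtain rfl : j = 0 := by omega
    simp [State.setNat, State.setReal]

theorem Searched.step {i : ℕ} (h : Searched M vnum enum s k w A i σ)
    (hc : Market.Cycle M s k w A) (hi : i < k) :
    Searched M vnum enum s k w A (i + 1) (minProg.den σ) := by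
  have hcur := h.rep.cur_of_ready (hc.ready i hi)
  have hpos := h.pos_eq
  have hstart := h.start_eq
  by_cases hlt : s.res (A i) < σ.realVar 0
  · have hden : minProg.den σ = ((((σ.setNat 7 (moveNum enum (A i))).setReal 0
        (s.res (A i))).setNat 6 (vnum (w i))).setNat 5 (vnum (w (i + 1)))) := by
      rw [hc.next i hi]
      simp [minProg, Prog.den, NatExp.eval, RealExp.eval, State.setNat, State.setReal, hpos, hcur,
        h.rep.res_eq, h.rep.target_eq, Test.Holds, hlt]
    rw [hden]
    refine ⟨h.rep.congr rfl rfl rfl rfl, ?_, ?_, by omega, hi, ⟨i, hi, ?_, ?_⟩, ?_⟩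
    · simp [State.setNat, State.setReal, hstart]
    · simp [State.setNat, State.setReal]
    · simp [State.setNat, State.setReal]
    · simp [State.setNat, State.setReal]
    · intro j hj
      simp only [State.setNat, State.setReal, Function.update_self]
      rcases Nat.lt_succ_iff_lt_or_eq.1 hj with h' | h'
      · exact hlt.le.trans (h.min_le j h')
      · rw [h']
  · have hden : minProg.den σ =
        ((σ.setNat 7 (moveNum enum (A i))).setNat 5 (vnum (w (i + 1)))) := by
      rw [hc.next i hi]
      simp [minProg, Prog.den, NatExp.eval, RealExp.eval, State.setNat, hpos, hcur,
        h.rep.res_eq, h.rep.target_eq, Test.Holds, hlt]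
    rw [hden]
    obtain ⟨y, hy, h6, h0⟩ := h.exists_min
    refine ⟨h.rep.congr rfl rfl rfl rfl, ?_, ?_, by omega, hi, ⟨y, hy, ?_, h0⟩, ?_⟩
    · simp [State.setNat, hstart]
    · simp [State.setNat]
    · simp [State.setNat, h6]
    · intro j hj
      rcases Nat.lt_succ_iff_lt_or_eq.1 hj with h' | h'
      · exact h.min_le j h'
      · rw [h']; exact not_lt.1 hlt

/-- The vertices of the cycle are distinct before position `k`, so a return to the start marks
exactly the end; position 0 has to be excluded. -/
theorem cycleTest_iff (hc : Market.Cycle M s k w A) {i : ℕ} (h3 : σ.natVar 3 = vnum (w 0))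
    (h5 : σ.natVar 5 = vnum (w i)) (h0 : 0 < i) (hi : i ≤ k) : cycleTest.Holds σ ↔ i < k := by
  simp only [cycleTest, Test.Holds, NatExp.eval, h3, h5, vnum_eq_iff]
  constructor
  · intro h
    refine lt_of_le_of_ne hi ?_
    rintro rfl
    exact h hc.closed
  · intro h h'
    have := hc.inj i h 0 hc.pos h'
    omega

theorem runs_search (hc : Market.Cycle M s k w A) {i : ℕ}
    (h : Searched M vnum enum s k w A i σ) :
    Runs (.while cycleTest minProg) σ ((cycleTest.cost + minProg.maxCost) * k + cycleTest.cost)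
      (Searched M vnum enum s k w A k) := by
  refine (Runs.loop (fun i σ => Searched M vnum enum s k w A i σ)
    (fun i => (cycleTest.cost + minProg.maxCost) * (k - i)) ?_ h).mono ?_ ?_
  · intro i σ h hb
    have hi := (cycleTest_iff hc h.start_eq h.pos_eq h.pos h.le).1 hb
    refine ⟨minProg.maxCost, Runs.of_loopFree (by simp [minProg, Prog.LoopFree])
      ⟨i + 1, h.step hc hi, ?_⟩⟩
    rw [show k - i = k - (i + 1) + 1 by omega, mul_add, mul_one]
    omega
  · exact Nat.add_le_add_right (Nat.mul_le_mul_left _ (Nat.sub_le _ _)) _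
  · rintro τ ⟨i, h, hb⟩
    have hi := mt (cycleTest_iff hc h.start_eq h.pos_eq h.pos h.le).2 hb
    have := h.le
    obtain rfl : i = k := by omega
    exact h

/-- The state of the rotation. -/
structure Rotating (M : Market V E) (vnum : V ≃ Fin n) (enum : E ≃ Fin m) (s : Config V E)
    (k : ℕ) (w : ℕ → V) (A : ℕ → E ⊕ E) (y : ℕ) (i : ℕ) (s' : Config V E) (σ : State) :
    Prop where
  rep : Rep M vnum enum σ s'
  start_eq : σ.natVar 3 = vnum (w 0)
  pos_eq : σ.natVar 5 = vnum (w i)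
  min_eq : σ.natVar 6 = vnum (w y)
  amount_eq : σ.realVar 0 = s.res (A y)
  le : i ≤ k
  rotated : Market.Rotated M s k w A (s.res (A y)) i s'

theorem Rotating.pass {y i : ℕ} (h : Rotating M vnum enum s k w A y i s' σ)
    (hc : Market.Cycle M s k w A) (hs : M.Inv s) (hi : i < k)
    (hy : ∀ j < k, s.res (A y) ≤ s.res (A j)) {x : ℕ} (hx7 : x ≠ 7)
    (hx : σ.natVar x = vnum (w i)) :
    Rotating M vnum enum s k w A y (i + 1) (s'.push (A i) (s.res (A y))) ((passProg x).den σ) := by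
  obtain ⟨h1, h2, h3, h4, h5⟩ := h.rep.pass hx7 h.rotated.inv (h.rotated.ready i hi) hx
  rw [h.amount_eq] at h1
  exact ⟨h1, by rw [h3, h.start_eq], by rw [h2, hc.next i hi], by rw [h4, h.min_eq],
    by rw [h5, h.amount_eq], hi, h.rotated.push hc hi (hs.nonneg _) hy⟩

/-- The least residual on the cycle drops to 0 and its owner advances: an event. Excesses are
unchanged, so no vertex becomes active. -/
theorem runs_rotate (hs : M.Inv s) (hb : M.LowerBound s) (hc : Market.Cycle M s k w A)
    (h : Rep M vnum enum σ s) (h3 : σ.natVar 3 = vnum (w 0)) :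
    Runs rotateProg σ (minInitProg.maxCost + ((cycleTest.cost + minProg.maxCost) * k +
      cycleTest.cost + ((passProg 3).maxCost + ((cycleTest.cost + (passProg 5).maxCost) * k +
      cycleTest.cost + (advanceProg 6).maxCost))))
      fun τ => ∃ s', Rep M vnum enum τ s' ∧ M.Inv s' ∧ M.LowerBound s' ∧
        M.events s' < M.events s ∧ ∀ v, M.Active s' v → M.Active s v := by
  refine Runs.seq (Runs.of_loopFree (Q := Searched M vnum enum s k w A 1)
    (by simp [minInitProg, Prog.LoopFree]) (h.searched_one hc h3)) fun σ h => ?_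
  refine Runs.seq (runs_search hc h) fun σ h => ?_
  obtain ⟨y, hy, h6, h0⟩ := h.exists_min
  have hmin : ∀ j < k, s.res (A y) ≤ s.res (A j) := h0 ▸ h.min_le
  have hrot : Rotating M vnum enum s k w A y 0 s σ :=
    ⟨h.rep, h.start_eq, by rw [h.pos_eq, hc.closed], h6, h0, Nat.zero_le _,
      hc.rotated_zero hs _⟩
  -- The first push is made outside the loop, whose test would fail at once at the starting vertex.
  refine Runs.seq (Runs.of_loopFree (Q := fun σ => Rotating M vnum enum s k w A y 1
    (s.push (A 0) (s.res (A y))) σ) (by simp [passProg, pushProg, Prog.LoopFree])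
    (hrot.pass hc hs hc.pos hmin (by simp) h.start_eq)) fun σ h => ?_
  refine Runs.seq (Q := fun σ => ∃ s', Rotating M vnum enum s k w A y k s' σ) ?_ fun σ h => ?_
  · refine (Runs.loop (g := (1, s.push (A 0) (s.res (A y))))
      (fun (g : ℕ × Config V E) σ => 0 < g.1 ∧ Rotating M vnum enum s k w A y g.1 g.2 σ)
      (fun g => (cycleTest.cost + (passProg 5).maxCost) * (k - g.1)) ?_ ⟨one_pos, h⟩).mono ?_ ?_
    · rintro ⟨i, s'⟩ σ ⟨hi0, h⟩ hb
      have hi := (cycleTest_iff hc h.start_eq h.pos_eq hi0 h.le).1 hb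
      refine ⟨(passProg 5).maxCost, Runs.of_loopFree
        (by simp [passProg, pushProg, Prog.LoopFree])
        ⟨(i + 1, _), ⟨Nat.succ_pos _, h.pass hc hs hi hmin (by simp) h.pos_eq⟩, ?_⟩⟩
      dsimp only
      rw [show k - i = k - (i + 1) + 1 by dsimp only at hi; omega, mul_add, mul_one]
      omega
    · exact Nat.add_le_add_right (Nat.mul_le_mul_left _ (Nat.sub_le _ _)) _
    · rintro τ ⟨⟨i, s'⟩, ⟨hi0, h⟩, hb⟩
      have hi := mt (cycleTest_iff hc h.start_eq h.pos_eq hi0 h.le).2 hb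
      have := h.le
      obtain rfl : i = k := by dsimp only at *; omega
      exact ⟨s', h⟩
  · obtain ⟨s', h⟩ := h
    have hr := h.rotated
    have hready := hr.ready y hy
    have hz : s'.res (A y) = 0 := by rw [hr.res_lt y hy hy, sub_self]
    refine Runs.of_loopFree (by simp [advanceProg, Prog.LoopFree]) ⟨s'.advance (w y),
      (h.rep.advance hr.inv hready h.min_eq).1, hr.inv.advance hready hz,
      (hr.lowerBound hc hb).advance _, (hr.inv.events_advance_lt hready).trans_le hr.events_le,
      fun v hv => (hr.active_iff hc v).1 (hr.inv.active_advance hready.internal hv)⟩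

end Walk
/-! ### The main loop -/

/-- Make progress as long as possible, beginning the search for a vertex that has to make a move at
the vertex in variable `2`. -/
def searchProg : Prog :=
  .while (.natLt (.var 2) (.var 0))
    (.ite (activeTest 2) (.seq phaseProg (.setNat 2 (.const 0)))
      (.setNat 2 (.add (.var 2) (.const 1))))

/-- A bound on the time of a phase, divided by `n + 2`. -/
def phaseCost : ℕ :=
  (Prog.seq (.setNat 3 (.var 2)) (.setNat 4 (.const 0))).maxCost +
    (walkTest.cost + stepProg.maxCost + walkTest.cost) +
    ((Test.and (.natEq (.var 4) (.add (.var 0) (.const 1))) (activeTest 3)).cost +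
    (minInitProg.maxCost + (cycleTest.cost + minProg.maxCost + cycleTest.cost +
      ((passProg 3).maxCost + (cycleTest.cost + (passProg 5).maxCost +
      cycleTest.cost + (advanceProg 6).maxCost)))))

/-- The time of one step of the search. -/
def scanCost : ℕ :=
  (Test.natLt (.var 2) (.var 0)).cost + (activeTest 2).cost +
    (Prog.setNat 2 (.add (.var 2) (.const 1))).maxCost

/-- A bound on the time of the search and of a phase, divided by `n + 2`. -/
def roundCost : ℕ :=
  (Test.natLt (.var 2) (.var 0)).cost + (activeTest 2).cost +
    (Prog.setNat 2 (.const 0)).maxCost + phaseCost + scanCost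

/-! ### Phases, the potential, and the search for active vertices -/

section Search

variable {V E : Type*} [Fintype V] [Fintype E] {n m : ℕ} {M : Market V E} {vnum : V ≃ Fin n}
  {enum : E ≃ Fin m} {σ τ : State} {s s' : Config V E}

/-- A walk of length `k` from `x` to `y` without progress. -/
structure Walked (M : Market V E) (s : Config V E) (x : V) (s' : Config V E) (k : ℕ) (y : V) :
    Prop where
  cur_eq : s'.cur = s.cur
  events_le : M.events s' ≤ M.events s
  -- Apart from the current end `y`, a vertex is active only if it was active before the walk, and
  -- the start has lost its surplus.
  card_lt : (open Classical in (M.activeSet s').erase y).card < (M.activeSet s).card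
  end_eq : y = (Market.succ M s)^[k] x
  ready : ∀ j < k, ∃ a, M.Ready s' ((Market.succ M s)^[j] x) a ∧
    M.lev s' ((Market.succ M s)^[j] x) ≤ M.ex s' ((Market.succ M s)^[j] x)

/-- Without events the lists of moves stay fixed, so the walk is an orbit of the single map `succ M
s`; vertices already visited stay ready and at or above their levels. -/
theorem Walked.moved {x y z : V} {k : ℕ} (h : Walked M s x s' k y) {s'' : Config V E}
    (h' : Moved M s' s'' y z) : Walked M s x s'' (k + 1) z := by
  obtain ⟨a, ha, hz⟩ := h'.exists_ready
  refine ⟨h'.cur_eq.trans h.cur_eq, h'.events_le.trans h.events_le,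
    (Finset.card_le_card h'.erase_subset).trans_lt h.card_lt, ?_, ?_⟩
  · rw [Function.iterate_succ_apply', ← h.end_eq, ← Market.succ_congr h.cur_eq, ha.succ_eq, hz]
  · intro j hj
    rcases Nat.lt_succ_iff_lt_or_eq.1 hj with hj | rfl
    · obtain ⟨b, hb, hl⟩ := h.ready j hj
      exact ⟨b, h'.ready _ _ hb, h'.lev_le _ (.inr hl)⟩
    · rw [← h.end_eq]
      exact ⟨a, h'.ready _ _ ha, h'.lev_le _ (.inl rfl)⟩

/-- The invariant of a walk. -/
structure Walking (M : Market V E) (vnum : V ≃ Fin n) (enum : E ≃ Fin m) (s : Config V E) (x : V)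
    (s' : Config V E) (k : ℕ) (σ : State) : Prop where
  rep : Rep M vnum enum σ s'
  count_eq : σ.natVar 4 = k
  inv : M.Inv s'
  lowerBound : M.LowerBound s'
  alternative : (k = n + 2 ∧ M.events s' < M.events s ∧
      (M.activeSet s').card ≤ (M.activeSet s).card + 1) ∨
    (k ≤ n + 1 ∧ ∃ y, σ.natVar 3 = vnum y ∧ Walked M s x s' k y)

theorem Walking.step {x : V} {k : ℕ} (h : Walking M vnum enum s x s' k σ)
    (hb : walkTest.Holds σ) :
    k < n + 2 ∧ ∃ s'' k', k < k' ∧ Walking M vnum enum s x s'' k' (stepProg.den σ) := by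
  have hk : k ≤ n := by
    have := hb.1
    simpa [Test.Holds, NatExp.eval, h.rep.n_eq, h.count_eq] using this
  refine ⟨by omega, ?_⟩
  rcases h.alternative with h' | ⟨-, y, h3, hw⟩
  · omega
  have hact := (h.rep.activeTest_iff h3).1 hb.2
  obtain ⟨s'', h1, h2, h4, ⟨h5, h6, h7⟩ | ⟨z, h5, h6, h7⟩⟩ :=
    h.rep.step h.inv h.lowerBound hact h3
  · refine ⟨s'', n + 2, by omega, h1, h5, h2, h4, .inl ⟨rfl, h6.trans_le hw.events_le, ?_⟩⟩
    have := hw.card_lt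
    omega
  · exact ⟨s'', k + 1, by omega, h1, by rw [h6, h.count_eq], h2, h4,
      .inr ⟨by omega, z, h5, hw.moved h7⟩⟩

/-- An event counts 2 and creates at most one more active vertex. Without an event the walk ends at
an inactive vertex, and the number of active vertices has dropped. -/
theorem runs_phase (hs : M.Inv s) (hb : M.LowerBound s) (h : Rep M vnum enum σ s) {x : V}
    (hx : M.Active s x) (h2 : σ.natVar 2 = vnum x) :
    Runs phaseProg σ (phaseCost * (n + 2)) fun τ => ∃ s', Rep M vnum enum τ s' ∧ M.Inv s' ∧
      M.LowerBound s' ∧ 2 * M.events s' + (M.activeSet s').card <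
        2 * M.events s + (M.activeSet s).card := by
  classical
  have hn : Fintype.card V = n := by rw [Fintype.card_congr vnum, Fintype.card_fin]
  have start : Walking M vnum enum s x s 0
      ((Prog.seq (.setNat 3 (.var 2)) (.setNat 4 (.const 0))).den σ) := by
    refine ⟨h.congr rfl rfl rfl rfl, ?_, hs, hb, .inr ⟨by omega, x, ?_, rfl, le_rfl, ?_, rfl, ?_⟩⟩
    · simp [Prog.den, State.setNat, NatExp.eval]
    · simp [Prog.den, State.setNat, NatExp.eval, h2]
    · exact Finset.card_erase_lt_of_mem (Market.mem_activeSet.2 hx)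
    · intro j hj
      omega
  set rot := minInitProg.maxCost + ((cycleTest.cost + minProg.maxCost) * n +
      cycleTest.cost + ((passProg 3).maxCost + ((cycleTest.cost + (passProg 5).maxCost) * n +
      cycleTest.cost + (advanceProg 6).maxCost))) with hrot
  refine (Runs.seq (Runs.of_loopFree (Q := fun τ => Walking M vnum enum s x s 0 τ)
    (by simp [Prog.LoopFree]) start) fun σ h => Runs.seq
    (T := (Test.and (.natEq (.var 4) (.add (.var 0) (.const 1))) (activeTest 3)).cost + rot)
    (S := (walkTest.cost + stepProg.maxCost) * (n + 2) + walkTest.cost)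
    (Q := fun τ => (∃ s' k, Walking M vnum enum s x s' k τ) ∧ ¬ walkTest.Holds τ) ?_
    ?_).mono ?_ fun _ h => h
  · refine (Runs.loop (g := (s, 0)) (fun (g : Config V E × ℕ) τ => Walking M vnum enum s x g.1 g.2 τ)
      (fun g => (walkTest.cost + stepProg.maxCost) * (n + 2 - g.2)) ?_ h).mono ?_ ?_
    · rintro ⟨s', k⟩ τ h hb
      obtain ⟨hk, s'', k', hkk, h'⟩ := h.step hb
      refine ⟨stepProg.maxCost, Runs.of_loopFree
        (by simp [stepProg, pushProg, advanceProg, Prog.LoopFree]) ⟨(s'', k'), h', ?_⟩⟩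
      dsimp only at hk hkk ⊢
      -- At an event the counter may jump by more than one.
      obtain ⟨d, hd⟩ : ∃ d, n + 2 - k = (n + 2 - k') + 1 + d := ⟨_, (Nat.add_sub_of_le (by omega)).symm⟩
      rw [hd, mul_add, mul_add, mul_one]
      omega
    · exact le_rfl
    · rintro τ ⟨⟨s', k⟩, h, hb⟩
      exact ⟨⟨s', k, h⟩, hb⟩
  · rintro τ ⟨⟨s', k, h⟩, hb⟩
    refine Runs.ite (fun ht => ?_) (fun ht => ?_)
    · have hk : k = n + 1 := by
        have := ht.1
        simpa [Test.Holds, NatExp.eval, h.rep.n_eq, h.count_eq] using this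
      rcases h.alternative with h' | ⟨-, y, h3, hw⟩
      · omega
      have hready := hw.ready
      rw [← Market.succ_congr hw.cur_eq] at hready
      -- After `n + 1` steps the end of the walk lies on a cycle, so the rotation may start at the
      -- vertex in variable `3`.
      obtain ⟨l, w, A, hc, hw0, hl⟩ := Market.exists_cycle (by omega : Fintype.card V ≤ k) hready
      rw [Market.succ_congr hw.cur_eq, ← hw.end_eq] at hw0
      have hln : l ≤ n := hn ▸ hl
      refine (runs_rotate h.inv h.lowerBound hc h.rep (by rw [hw0]; exact h3)).mono ?_ ?_
      · rw [hrot]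
        gcongr
      · rintro ρ ⟨s'', h1, h2, h4, h5, h6⟩
        refine ⟨s'', h1, h2, h4, ?_⟩
        have e1 : (M.activeSet s'').card ≤ (M.activeSet s').card :=
          Finset.card_le_card fun v hv =>
            Market.mem_activeSet.2 (h6 v (Market.mem_activeSet.1 hv))
        have e2 := Finset.pred_card_le_card_erase (s := M.activeSet s') (a := y)
        have e3 := hw.card_lt
        have e4 := hw.events_le
        omega
    · refine (Runs.of_loopFree (P := .skip) (by simp [Prog.LoopFree]) (Q := fun τ => ∃ s', Rep M vnum enum τ s' ∧
        M.Inv s' ∧ M.LowerBound s' ∧ 2 * M.events s' + (M.activeSet s').card <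
          2 * M.events s + (M.activeSet s).card)
          ⟨s', h.rep, h.inv, h.lowerBound, ?_⟩).mono ?_ fun _ h => h
      · rcases h.alternative with ⟨-, h1, h2⟩ | ⟨hk, y, h3, hw⟩
        · omega
        -- An active end would have continued the walk if `k ≤ n`, and started a rotation if `k = n
        -- + 1`.
        · have hna : ¬ M.Active s' y := by
            intro hact
            have hat := (h.rep.activeTest_iff h3).2 hact
            have hkn : k ≠ n + 1 := by
              intro hkn
              refine ht ⟨?_, hat⟩
              simp [Test.Holds, NatExp.eval, h.rep.n_eq, h.count_eq, hkn]
            refine hb ⟨?_, hat⟩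
            simp only [Test.Holds, NatExp.eval, h.rep.n_eq, h.count_eq]
            omega
          have e3 := hw.card_lt
          rw [Finset.erase_eq_of_notMem (by rwa [Market.mem_activeSet])] at e3
          have e4 := hw.events_le
          omega
      · have : Prog.skip.maxCost ≤ minInitProg.maxCost := by
          simp [Prog.maxCost, minInitProg]
          omega
        omega
  · have h1 : ∀ c, c ≤ c * (n + 2) := fun c => Nat.le_mul_of_pos_right c (by omega)
    have h2 : ∀ c, c * n ≤ c * (n + 2) := fun c => Nat.mul_le_mul_left c (by omega)
    rw [hrot, phaseCost]
    generalize (Prog.seq (.setNat 3 (.var 2)) (.setNat 4 (.const 0))).maxCost = c₁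
    generalize (Test.and (.natEq (.var 4) (.add (.var 0) (.const 1))) (activeTest 3)).cost = c₂
    generalize walkTest.cost = c₃, stepProg.maxCost = c₄, minInitProg.maxCost = c₅,
      cycleTest.cost = c₆, minProg.maxCost = c₇, (passProg 3).maxCost = c₈,
      (passProg 5).maxCost = c₉, (advanceProg 6).maxCost = c₁₀
    have a₁ := h1 c₁
    have a₂ := h1 c₂
    have a₃ := h1 c₃
    have a₅ := h1 c₅
    have a₆ := h1 c₆
    have a₆' := h2 c₆
    have a₇ := h2 c₇
    have a₈ := h1 c₈
    have a₉ := h2 c₉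
    have a₁₀ := h1 c₁₀
    generalize hN : n + 2 = N at *
    simp only [add_mul]
    omega

/-- Each unit of the potential `2 * events + |active|` pays for one phase and for a complete new
scan of the vertices; the scan index pays for single scan steps. -/
theorem runs_search_loop (hs : M.Inv s) (hb : M.LowerBound s) (h : Rep M vnum enum σ s)
    (h2 : σ.natVar 2 = 0) :
    Runs searchProg σ (roundCost * (n + 2) * (2 * M.events s + (M.activeSet s).card + 1))
      fun τ => ∃ s', Rep M vnum enum τ s' ∧ M.Inv s' ∧ M.LowerBound s' ∧
        ∀ v, ¬ M.Active s' v := by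
  refine (Runs.loop (g := (s, 0)) (fun (g : Config V E × ℕ) τ => Rep M vnum enum τ g.1 ∧
    M.Inv g.1 ∧ M.LowerBound g.1 ∧ τ.natVar 2 = g.2 ∧ ∀ v, (vnum v : ℕ) < g.2 → ¬ M.Active g.1 v)
    (fun g => roundCost * (n + 2) * (2 * M.events g.1 + (M.activeSet g.1).card) +
      scanCost * (n - g.2)) ?_ ⟨h, hs, hb, h2, by simp⟩).mono ?_ ?_
  · rintro ⟨s, u⟩ τ ⟨h, hs, hb, h2, hu⟩ ht
    have hun : u < n := by simpa [Test.Holds, NatExp.eval, h2, h.n_eq] using ht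
    obtain ⟨x, hx⟩ : ∃ x, vnum x = ⟨u, hun⟩ := ⟨vnum.symm ⟨u, hun⟩, by simp⟩
    have h2x : τ.natVar 2 = vnum x := by rw [h2, hx]
    dsimp only at *
    by_cases hact : M.Active s x
    · have hT := Runs.ite (b := activeTest 2) (σ := τ)
        (P' := .setNat 2 (.add (.var 2) (.const 1))) (fun _ =>
        Runs.seq (runs_phase hs hb h hact h2x) fun ρ hρ =>
          Runs.of_loopFree (P := .setNat 2 (.const 0)) (by simp [Prog.LoopFree])
          (Q := fun ρ' => ∃ s', Rep M vnum enum ρ' s' ∧ M.Inv s' ∧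
            M.LowerBound s' ∧ 2 * M.events s' + (M.activeSet s').card <
              2 * M.events s + (M.activeSet s).card ∧ ρ'.natVar 2 = 0)
          (by
            obtain ⟨s', a1, a2, a3, a4⟩ := hρ
            exact ⟨s', a1.congr rfl rfl rfl rfl, a2, a3, a4,
              by simp [Prog.den, State.setNat, NatExp.eval]⟩))
        (fun hn => absurd ((h.activeTest_iff h2x).2 hact) hn)
      refine ⟨_, hT.mono le_rfl ?_⟩
      rintro ρ ⟨s', a1, a2, a3, a4, a5⟩
      refine ⟨(s', 0), ⟨a1, a2, a3, a5, by simp⟩, ?_⟩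
      dsimp only
      -- The potential drops by at least one unit, worth `roundCost * (n + 2)`; the index returns to
      -- 0, which restores a debt of `scanCost * n`.
      obtain ⟨d, hd⟩ := Nat.exists_eq_add_of_lt a4
      rw [hd]
      generalize 2 * M.events s' + (M.activeSet s').card = p
      rw [show roundCost * (n + 2) * (p + d + 1) = roundCost * (n + 2) * p + roundCost * (n + 2) +
        roundCost * (n + 2) * d by ring]
      have h1 : ∀ c, c ≤ c * (n + 2) := fun c => Nat.le_mul_of_pos_right c (by omega)
      have h3 : scanCost * n ≤ scanCost * (n + 2) := Nat.mul_le_mul_left _ (by omega)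
      have h4 := h1 (Test.natLt (.var 2) (.var 0)).cost
      have h5 := h1 (activeTest 2).cost
      have h6 := h1 (Prog.setNat 2 (.const 0)).maxCost
      have h7 : roundCost * (n + 2) = (Test.natLt (.var 2) (.var 0)).cost * (n + 2) +
          (activeTest 2).cost * (n + 2) + (Prog.setNat 2 (.const 0)).maxCost * (n + 2) +
          phaseCost * (n + 2) + scanCost * (n + 2) := by
        rw [roundCost]; ring
      rw [Nat.sub_zero]
      omega
    · have hT := Runs.ite (b := activeTest 2) (σ := τ)
        (P := .seq phaseProg (.setNat 2 (.const 0)))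
        (fun hn => absurd ((h.activeTest_iff h2x).1 hn) hact)
        (fun _ => Runs.of_loopFree (P := .setNat 2 (.add (.var 2) (.const 1)))
          (by simp [Prog.LoopFree])
          (Q := fun ρ => Rep M vnum enum ρ s ∧ ρ.natVar 2 = u + 1)
          ⟨h.congr rfl rfl rfl rfl, by simp [Prog.den, State.setNat, NatExp.eval, h2]⟩)
      refine ⟨_, hT.mono le_rfl ?_⟩
      rintro ρ ⟨a1, a2⟩
      refine ⟨(s, u + 1), ⟨a1, hs, hb, a2, ?_⟩, ?_⟩
      · intro v hv
        rcases Nat.lt_succ_iff_lt_or_eq.1 hv with h' | h'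
        · exact hu v h'
        · have : v = x := vnum.injective (Fin.ext (by rw [hx]; exact h'))
          rwa [this]
      · dsimp only
        rw [show n - u = n - (u + 1) + 1 by omega, mul_add scanCost, mul_one]
        have : scanCost = (Test.natLt (.var 2) (.var 0)).cost + (activeTest 2).cost +
          (Prog.setNat 2 (.add (.var 2) (.const 1))).maxCost := rfl
        omega
  · dsimp only
    rw [mul_add _ _ 1, mul_one, add_assoc]
    gcongr
    have h3 : (Test.natLt (.var 2) (.var 0)).cost ≤ (Test.natLt (.var 2) (.var 0)).cost * (n + 2) :=
      Nat.le_mul_of_pos_right _ (by omega)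
    have h4 : (scanCost + (Test.natLt (.var 2) (.var 0)).cost) * (n + 2) ≤ roundCost * (n + 2) :=
      Nat.mul_le_mul_right _ (by rw [roundCost]; omega)
    have h5 : scanCost * (n - 0) ≤ scanCost * (n + 2) := Nat.mul_le_mul_left _ (by omega)
    rw [add_mul] at h4
    omega
  · rintro τ ⟨⟨s', u⟩, ⟨a1, a2, a3, a4, a5⟩, hb⟩
    refine ⟨s', a1, a2, a3, fun v => a5 v ?_⟩
    have : n ≤ u := by simpa [Test.Holds, NatExp.eval, a4, a1.n_eq] using hb
    exact (vnum v).2.trans_le this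

end Search
/-! ### Initialization -/

/-- Initialize the data of the vertex in variable `2`. -/
def vertexProg : Prog :=
  .seq (.storeReal 4 (.var 2) .zero)
  (.seq (.ite (.natEq (.arr 3 (.var 2)) (.var 1))
    (.seq (.storeNat 11 (.var 2) (.arr 8 (.var 2))) (.storeReal 5 (.var 2) (.arr 2 (.var 2))))
    (.seq (.storeNat 11 (.var 2) (.add (.add (.var 1) (.const 1)) (.arr 3 (.var 2))))
      (.storeReal 5 (.var 2) (.sub .zero (.arr 1 (.var 2))))))
  (.setNat 2 (.add (.var 2) (.const 1))))

/-- The number of the increase of the flow on the edge in variable `2`. -/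
def forwardExp : NatExp := .add (.add (.var 1) (.const 1)) (.var 2)

/-- Initialize the data of the edge in variable `2`. -/
def edgeProg : Prog :=
  .seq (.storeNat 12 (.var 2) (.arr 10 (.var 2)))
  (.seq (.ite (.natEq (.arr 5 (.var 2)) (.var 1))
    (.storeNat 12 forwardExp (.arr 8 (.arr 1 (.var 2))))
    (.storeNat 12 forwardExp (.add (.add (.var 1) (.const 1)) (.arr 5 (.var 2)))))
  (.seq (.storeNat 13 (.var 2) (.arr 1 (.var 2)))
  (.seq (.storeNat 13 forwardExp (.arr 2 (.var 2)))
  (.seq (.ite (.natEq (.arr 0 (.arr 1 (.var 2))) (.const 1))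
    (.seq (.storeReal 3 forwardExp .zero) (.seq (.storeReal 3 (.var 2) (.arr 0 (.var 2)))
      (.seq (.storeReal 4 (.arr 1 (.var 2)) (.sub (.arr 4 (.arr 1 (.var 2))) (.arr 0 (.var 2))))
      (.storeReal 4 (.arr 2 (.var 2)) (.add (.arr 4 (.arr 2 (.var 2))) (.arr 0 (.var 2)))))))
    (.seq (.storeReal 3 forwardExp (.arr 0 (.var 2))) (.storeReal 3 (.var 2) .zero)))
  (.setNat 2 (.add (.var 2) (.const 1)))))))

/-- Initialize the data of the algorithm. -/
def initProg : Prog :=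
  .seq (.setNat 2 (.const 0)) (.seq (.while (.natLt (.var 2) (.var 0)) vertexProg)
  (.seq (.setNat 2 (.const 0)) (.seq (.while (.natLt (.var 2) (.var 1)) edgeProg)
  (.setNat 2 (.const 0)))))

/-- A bound on the time of the initialization, divided by `n + m + 1`. -/
def initCost : ℕ :=
  3 * (Prog.setNat 2 (.const 0)).maxCost + 2 * (Test.natLt (.var 2) (.var 0)).cost +
    2 * (Test.natLt (.var 2) (.var 1)).cost + vertexProg.maxCost + edgeProg.maxCost

theorem den_vertexProg (σ : State) : vertexProg.den σ =
    let u := σ.natVar 2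
    { natVar := Function.update σ.natVar 2 (u + 1)
      realVar := σ.realVar
      natArr := Function.update σ.natArr 11 (Function.update (σ.natArr 11) u
        (if σ.natArr 3 u = σ.natVar 1 then σ.natArr 8 u else σ.natVar 1 + 1 + σ.natArr 3 u))
      realArr := Function.update (Function.update σ.realArr 4 (Function.update (σ.realArr 4) u 0)) 5
        (Function.update (σ.realArr 5) u
          (if σ.natArr 3 u = σ.natVar 1 then σ.realArr 2 u else 0 - σ.realArr 1 u)) } := by
  by_cases h : σ.natArr 3 (σ.natVar 2) = σ.natVar 1 <;>
    simp [vertexProg, Prog.den, State.storeReal, State.storeNat, State.setNat, NatExp.eval,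
      RealExp.eval, Test.Holds, h]

theorem den_edgeProg (σ : State) : edgeProg.den σ =
    let u := σ.natVar 2
    let b := σ.natVar 1 + 1 + u
    let t := σ.natArr 1 u
    let h := σ.natArr 2 u
    let c := σ.realArr 0 u
    let g := Function.update (σ.realArr 4) t (σ.realArr 4 t - c)
    { natVar := Function.update σ.natVar 2 (u + 1)
      realVar := σ.realVar
      natArr := Function.update (Function.update σ.natArr 12 (Function.update
        (Function.update (σ.natArr 12) u (σ.natArr 10 u)) b
        (if σ.natArr 5 u = σ.natVar 1 then σ.natArr 8 t else σ.natVar 1 + 1 + σ.natArr 5 u))) 13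
        (Function.update (Function.update (σ.natArr 13) u t) b h)
      realArr := Function.update (Function.update σ.realArr 3
        (Function.update (Function.update (σ.realArr 3) b (if σ.natArr 0 t = 1 then 0 else c)) u
          (if σ.natArr 0 t = 1 then c else 0))) 4
        (if σ.natArr 0 t = 1 then Function.update g h (g h + c) else σ.realArr 4) } := by
  by_cases h : σ.natArr 5 (σ.natVar 2) = σ.natVar 1 <;>
  by_cases h' : σ.natArr 0 (σ.natArr 1 (σ.natVar 2)) = 1 <;>
    simp [edgeProg, Prog.den, State.storeReal, State.storeNat, State.setNat, NatExp.eval,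
      RealExp.eval, Test.Holds, h, h', forwardExp]

/-! ### The linked lists of moves and the initial configuration -/

section Init

variable {V E : Type*} {n m : ℕ}

/-- The number of the first edge in a list, and `m` if there is none. -/
def firstEdge (enum : E ≃ Fin m) (l : List E) : ℕ := (l.map fun e => (enum e : ℕ)).headD m

theorem firstEdge_eq_iff (enum : E ≃ Fin m) (l : List E) : firstEdge enum l = m ↔ l = [] := by
  cases l with
  | nil => simp [firstEdge]
  | cons e l => simp [firstEdge, (enum e).2.ne]

theorem firstNum_map_inr (enum : E ≃ Fin m) (l : List E) :
    firstNum enum (l.map .inr) = firstEdge enum l := by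
  cases l <;> simp [firstNum, firstEdge, moveNum]

/-- How the two lists of a vertex are joined: where no leaving edge remains, the pointer goes to the
first rejection, that is, to the last entering edge. -/
theorem firstNum_append (enum : E ≃ Fin m) (l l' : List E) :
    firstNum enum (l.map .inl ++ l'.map .inr) =
      if firstEdge enum l = m then firstEdge enum l' else m + 1 + firstEdge enum l := by
  cases l with
  | nil => simpa [firstEdge] using firstNum_map_inr enum l'
  | cons e l => simp [firstNum, firstEdge, moveNum, (enum e).2.ne]

theorem inl_cons_suffix {e : E} {X Y : List E} {l : List (E ⊕ E)}
    (h : .inl e :: l <:+ X.map .inl ++ Y.map .inr) :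
    ∃ l', e :: l' <:+ X ∧ l = l'.map .inl ++ Y.map .inr := by
  induction X with
  | nil =>
    have := h.subset (List.mem_cons_self)
    simp at this
  | cons x X ih =>
    rw [List.map_cons, List.cons_append, List.suffix_cons_iff] at h
    rcases h with h | h
    · simp only [List.cons.injEq, Sum.inl.injEq] at h
      exact ⟨X, by rw [h.1], h.2⟩
    · obtain ⟨l', h1, h2⟩ := ih h
      exact ⟨l', h1.trans (List.suffix_cons _ _), h2⟩

theorem inr_cons_suffix {e : E} {X Y : List E} {l : List (E ⊕ E)}
    (h : .inr e :: l <:+ X.map .inl ++ Y.map .inr) :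
    ∃ l', e :: l' <:+ Y ∧ l = l'.map .inr := by
  induction X with
  | nil =>
    rw [List.map_nil, List.nil_append] at h
    induction Y with
    | nil => simp at h
    | cons y Y ih =>
      rw [List.map_cons, List.suffix_cons_iff] at h
      rcases h with h | h
      · simp only [List.cons.injEq, Sum.inr.injEq] at h
        exact ⟨Y, by rw [h.1], h.2⟩
      · obtain ⟨l', h1, h2⟩ := ih h
        exact ⟨l', h1.trans (List.suffix_cons _ _), h2⟩
  | cons x X ih =>
    rw [List.map_cons, List.cons_append, List.suffix_cons_iff] at h
    rcases h with h | h
    · simp at h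
    · exact ih h

/-- The memory `σ` holds the data `M`. -/
structure Input (M : Market V E) (vnum : V ≃ Fin n) (enum : E ≃ Fin m) (σ : State) : Prop where
  n_eq : σ.natVar 0 = n
  m_eq : σ.natVar 1 = m
  kind_iff : ∀ v, σ.natArr 0 (vnum v) = 0 ↔ M.internal v
  source_iff : ∀ e, σ.natArr 0 (vnum (M.tail e)) = 1 ↔ ¬ M.internal (M.tail e)
  tail_eq : ∀ e, σ.natArr 1 (enum e) = vnum (M.tail e)
  head_eq : ∀ e, σ.natArr 2 (enum e) = vnum (M.head e)
  first_out : ∀ v, σ.natArr 3 (vnum v) = firstEdge enum (M.outL v)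
  next_out : ∀ v e l, e :: l <:+ M.outL v → σ.natArr 5 (enum e) = firstEdge enum l
  last_in : ∀ v, σ.natArr 8 (vnum v) = firstEdge enum (M.inL v).reverse
  prev_in : ∀ v e l, e :: l <:+ (M.inL v).reverse → σ.natArr 10 (enum e) = firstEdge enum l
  cap_eq : ∀ e, σ.realArr 0 (enum e) = M.cap e
  low_eq : ∀ v, M.internal v → σ.realArr 1 (vnum v) = M.low v
  high_eq : ∀ v, M.internal v → σ.realArr 2 (vnum v) = M.high v

variable {M : Market V E} {vnum : V ≃ Fin n} {enum : E ≃ Fin m} {σ τ : State}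

theorem Input.congr (h : Input M vnum enum σ) (h0 : τ.natVar 0 = σ.natVar 0)
    (h1 : τ.natVar 1 = σ.natVar 1) (h2 : ∀ k ≤ 10, τ.natArr k = σ.natArr k)
    (h3 : ∀ k ≤ 2, τ.realArr k = σ.realArr k) : Input M vnum enum τ := by
  obtain ⟨a1, a2, a3, a4, a5, a6, a7, a8, a9, a10, a11, a12, a13⟩ := h
  refine ⟨?_, ?_, ?_, ?_, ?_, ?_, ?_, ?_, ?_, ?_, ?_, ?_, ?_⟩ <;>
    simpa only [h0, h1, h2 0 (by simp), h2 1 (by simp), h2 2 (by simp), h2 3 (by simp),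
      h2 5 (by simp), h2 8 (by simp), h2 10 (by simp), h3 0 (by simp), h3 1 (by simp),
      h3 2 (by simp)]

/-- The initial state of the algorithm: the edges that leave sources are saturated. -/
noncomputable def initial (M : Market V E) : Config V E :=
  open Classical in
  { res := Sum.elim (fun e => if M.internal (M.tail e) then M.cap e else 0)
      (fun e => if M.internal (M.tail e) then 0 else M.cap e)
    cur := fun v => if M.internal v then M.full v else [] }

/-- Edges leaving internal vertices have their full capacity as residual, and the other edges are
saturated. -/
theorem not_closed_initial (e : E) : ¬ M.Closed (initial M) e := by
  rintro ⟨h1, h2⟩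
  by_cases h : M.internal (M.tail e)
  · simp only [initial, Config.flow, Sum.elim_inl, Sum.elim_inr, if_pos h] at h1 h2
    exact h2.ne h1.symm
  · simp [initial, Config.flow, h] at h2

theorem inv_initial (M : Market V E) : M.Inv (initial M) where
  nonneg a := by
    rcases a with e | e <;> simp only [initial, Sum.elim_inl, Sum.elim_inr] <;> split_ifs <;>
      simp [M.cap_nonneg]
  flow_le e := by
    simp only [initial, Config.flow, Sum.elim_inr]
    split_ifs
    · exact M.cap_nonneg e
    · exact le_rfl
  res_inl e := by
    by_cases h : M.internal (M.tail e) <;> simp [initial, Config.flow, h]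
  suffix v hv := by simp [initial, hv]
  of_notMem_inl e he := by
    by_cases h : M.internal (M.tail e)
    · refine absurd ?_ he
      simp [initial, h, M.mem_full, Market.owner]
    · simp [initial, h]
  of_notMem_inr e hi he := by
    refine absurd ?_ he
    simp [initial, hi, M.mem_full, Market.owner]
  of_closed e he := absurd he (not_closed_initial e)
  of_mem_tail e he := by
    by_cases h : M.internal (M.tail e)
    · simp [initial, Config.flow, h]
    · simp [initial, h] at he
  cur_eq_nil v hv := by simp [initial, hv]

/-- Initially no flow leaves an internal vertex, so its excess is nonnegative. -/
theorem lowerBound_initial [Fintype E] (M : Market V E) : M.LowerBound (initial M) where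
  low_le v hv := by
    refine (neg_nonpos.2 (M.low_nonneg v)).trans (Finset.sum_nonneg fun e _ => ?_)
    have h0 : 0 ≤ (initial M).flow e := (inv_initial M).nonneg _
    by_cases h : M.tail e = v
    · have : (initial M).flow e = 0 := by simp [initial, Config.flow, h, hv]
      simp [this]
    · rw [if_neg h, sub_zero]
      split_ifs
      · exact h0
      · exact le_rfl
  high_le e he := absurd he (not_closed_initial e)

/-- The vertices with numbers less than `i` have been initialized. -/
structure VertexInit (M : Market V E) (vnum : V ≃ Fin n) (enum : E ≃ Fin m) (i : ℕ)
    (σ : State) : Prop where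
  input : Input M vnum enum σ
  index_eq : σ.natVar 2 = i
  cur_eq : ∀ v, (vnum v : ℕ) < i → σ.natArr 11 (vnum v) = firstNum enum (M.full v)
  ex_eq : ∀ v, (vnum v : ℕ) < i → σ.realArr 4 (vnum v) = 0
  lev_eq : ∀ v, (vnum v : ℕ) < i → M.internal v → σ.realArr 5 (vnum v) = M.lev (initial M) v

theorem VertexInit.step {v : V} (h : VertexInit M vnum enum (vnum v) σ) :
    VertexInit M vnum enum (vnum v + 1) (vertexProg.den σ) := by
  have hi := h.input
  have hlt : ∀ w, (vnum w : ℕ) < vnum v + 1 ↔ w = v ∨ (vnum w : ℕ) ≠ vnum v ∧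
      (vnum w : ℕ) < vnum v := by
    intro w
    rw [← vnum_eq_iff vnum]
    omega
  rw [den_vertexProg]
  refine ⟨hi.congr ?_ ?_ ?_ ?_, ?_, ?_, ?_, ?_⟩
  · simp
  · simp
  · intro k hk
    simp [show k ≠ 11 by omega]
  · intro k hk
    simp [show k ≠ 4 by omega, show k ≠ 5 by omega]
  · simp [h.index_eq]
  · intro w hw
    rcases (hlt w).1 hw with rfl | ⟨hne, hw⟩
    · rw [Market.full, firstNum_append]
      simp [h.index_eq, hi.m_eq, hi.first_out, hi.last_in]
    · simpa [h.index_eq, hne] using h.cur_eq w hw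
  · intro w hw
    rcases (hlt w).1 hw with rfl | ⟨hne, hw⟩
    · simp [h.index_eq]
    · simpa [h.index_eq, hne] using h.ex_eq w hw
  · intro w hw hint
    rcases (hlt w).1 hw with rfl | ⟨hne, hw⟩
    · simp only [h.index_eq, hi.m_eq, hi.first_out, firstEdge_eq_iff, Function.update_self,
        hi.low_eq w hint, hi.high_eq w hint]
      cases hc : M.outL w with
      | nil =>
        rw [if_pos rfl, Market.lev_of_forall]
        intro a ha
        simp only [initial, hint, if_true, Market.full, hc, List.map_nil, List.nil_append,
          List.mem_map] at ha
        obtain ⟨e, -, rfl⟩ := ha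
        exact ⟨e, rfl⟩
      | cons e l => simp [Market.lev, initial, hint, Market.full, hc]
    · simpa [h.index_eq, hne] using h.lev_eq w hw hint

/-- The edges with numbers less than `i` have been initialized. -/
structure EdgeInit [Fintype E] (M : Market V E) (vnum : V ≃ Fin n) (enum : E ≃ Fin m) (i : ℕ)
    (σ : State) : Prop where
  input : Input M vnum enum σ
  index_eq : σ.natVar 2 = i
  cur_eq : ∀ v, σ.natArr 11 (vnum v) = firstNum enum (M.full v)
  lev_eq : ∀ v, M.internal v → σ.realArr 5 (vnum v) = M.lev (initial M) v
  next_eq : ∀ e, (enum e : ℕ) < i → ∀ a, a = .inl e ∨ a = .inr e →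
    ∀ l, a :: l <:+ M.full (M.owner a) → σ.natArr 12 (moveNum enum a) = firstNum enum l
  target_eq : ∀ e, (enum e : ℕ) < i → ∀ a, a = .inl e ∨ a = .inr e →
    σ.natArr 13 (moveNum enum a) = vnum (M.target a)
  res_eq : ∀ e, (enum e : ℕ) < i → ∀ a, a = .inl e ∨ a = .inr e →
    σ.realArr 3 (moveNum enum a) = (initial M).res a
  ex_eq : ∀ v, σ.realArr 4 (vnum v) =
    M.excess (fun e => if (enum e : ℕ) < i then (initial M).flow e else 0) v

theorem EdgeInit.step [Fintype E] {e : E} (h : EdgeInit M vnum enum (enum e) σ) :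
    EdgeInit M vnum enum (enum e + 1) (edgeProg.den σ) := by
  classical
  have hi := h.input
  have hlt : ∀ e', (enum e' : ℕ) < enum e + 1 ↔ e' = e ∨ e' ≠ e ∧ (enum e' : ℕ) < enum e := by
    intro e'
    rw [Ne, ← vnum_eq_iff enum]
    omega
  have hb : m + 1 + (enum e : ℕ) = moveNum enum (.inl e) := rfl
  have hu : (enum e : ℕ) = moveNum enum (.inr e) := rfl
  rw [den_edgeProg]
  simp only [h.index_eq, hi.m_eq, hb, hi.tail_eq, hi.head_eq, hi.cap_eq, hi.source_iff]
  refine ⟨hi.congr ?_ ?_ ?_ ?_, ?_, ?_, ?_, ?_, ?_, ?_, ?_⟩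
  · simp
  · simp
  · intro k hk
    simp [show k ≠ 12 by omega, show k ≠ 13 by omega]
  · intro k hk
    simp [show k ≠ 3 by omega, show k ≠ 4 by omega]
  · simp
  · simpa using h.cur_eq
  · simpa using h.lev_eq
  · intro e' he' a ha l hl
    rcases (hlt e').1 he' with rfl | ⟨hne, he'⟩
    · rcases ha with rfl | rfl
      · obtain ⟨l', h1, rfl⟩ := inl_cons_suffix hl
        rw [firstNum_append]
        simp [hi.next_out _ _ _ h1, hi.last_in]
        rfl
      · obtain ⟨l', h1, rfl⟩ := inr_cons_suffix hl
        have hne : moveNum enum (.inr e') ≠ moveNum enum (.inl e') := by simp [moveNum_eq_iff]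
        simp only [Function.update_self, Function.update_of_ne (show (12 : ℕ) ≠ 13 by simp)]
        rw [Function.update_of_ne hne, moveNum_inr, Function.update_self, hi.prev_in _ _ _ h1,
          firstNum_map_inr]
    · refine Eq.trans ?_ (h.next_eq e' he' a ha l hl)
      rw [hu]
      rcases ha with rfl | rfl <;> simp [moveNum_eq_iff, hne]
  · intro e' he' a ha
    rcases (hlt e').1 he' with rfl | ⟨hne, he'⟩
    · rw [hu]
      rcases ha with rfl | rfl <;>
        simp [moveNum_eq_iff, Market.target]
    · refine Eq.trans ?_ (h.target_eq e' he' a ha)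
      rw [hu]
      rcases ha with rfl | rfl <;> simp [moveNum_eq_iff, hne]
  · intro e' he' a ha
    rcases (hlt e').1 he' with rfl | ⟨hne, he'⟩
    · rw [hu]
      rcases ha with rfl | rfl <;>
        simp [Function.update_apply, moveNum_eq_iff, initial]
    · refine Eq.trans ?_ (h.res_eq e' he' a ha)
      rw [hu]
      rcases ha with rfl | rfl <;> simp [Function.update_apply, moveNum_eq_iff, hne]
  · intro v
    -- Processing `e` raises its counted flow from 0 to its initial flow, so `excess_update`
    -- applies.
    have hf : (fun e' => if (enum e' : ℕ) < enum e + 1 then (initial M).flow e' else 0) =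
        Function.update (fun e' => if (enum e' : ℕ) < enum e then (initial M).flow e' else 0) e
        ((if (enum e : ℕ) < enum e then (initial M).flow e else 0) + (initial M).flow e) := by
      ext e'
      by_cases he : e' = e
      · subst he
        simp
      · rw [Function.update_of_ne he]
        simp [hlt, he]
    rw [hf, Market.excess_update, ← h.ex_eq]
    by_cases hint : M.internal (M.tail e)
    · have : (initial M).flow e = 0 := by simp [initial, Config.flow, hint]
      simp [hint, this]
    · have : (initial M).flow e = M.cap e := by simp [initial, Config.flow, hint]
      simp only [hint, this, not_false_eq_true, if_true, Function.update_self,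
        Function.update_apply, vnum_eq_iff]
      by_cases h1 : v = M.head e
      · subst h1
        -- For a loop the subtraction and the addition hit the same cell.
        by_cases h2 : M.head e = M.tail e
        · simp [h2]
        · simp [h2, Ne.symm h2]
      · by_cases h2 : v = M.tail e
        · subst h2
          simp [h1, Ne.symm h1]
          ring
        · simp [h1, h2, Ne.symm h1, Ne.symm h2]

theorem EdgeInit.rep [Fintype E] (h : EdgeInit M vnum enum m σ) :
    Rep M vnum enum σ (initial M) where
  n_eq := h.input.n_eq
  m_eq := h.input.m_eq
  kind_iff := h.input.kind_iff
  high_eq := h.input.high_eq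
  cur_eq v hv := by rw [h.cur_eq v]; simp [initial, hv]
  next_eq v _ a l hl := by
    have hown : M.owner a = v := M.mem_full.1 (hl.subset (by simp))
    subst hown
    rcases a with e | e
    · exact h.next_eq e (enum e).2 _ (.inl rfl) l hl
    · exact h.next_eq e (enum e).2 _ (.inr rfl) l hl
  target_eq a := by
    rcases a with e | e
    · exact h.target_eq e (enum e).2 _ (.inl rfl)
    · exact h.target_eq e (enum e).2 _ (.inr rfl)
  res_eq a := by
    rcases a with e | e
    · exact h.res_eq e (enum e).2 _ (.inl rfl)
    · exact h.res_eq e (enum e).2 _ (.inr rfl)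
  ex_eq v := by
    rw [h.ex_eq v]
    simp
  lev_eq := h.lev_eq

theorem runs_init [Fintype E] (h : Input M vnum enum σ) :
    Runs initProg σ (initCost * (n + m + 1)) fun τ => Rep M vnum enum τ (initial M) ∧
      τ.natVar 2 = 0 := by
  have hset : ∀ {σ : State}, Input M vnum enum σ →
      Input M vnum enum ((Prog.setNat 2 (.const 0)).den σ) := fun h =>
    h.congr (by simp [Prog.den, State.setNat]) (by simp [Prog.den, State.setNat])
      (fun _ _ => rfl) (fun _ _ => rfl)
  refine (Runs.seq (Runs.of_loopFree (Q := VertexInit M vnum enum 0) (by simp [Prog.LoopFree])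
    ⟨hset h, by simp [Prog.den, State.setNat, NatExp.eval], by simp, by simp, by simp⟩)
    fun σ h => ?_ : Runs initProg σ ((Prog.setNat 2 (.const 0)).maxCost +
      (((Test.natLt (.var 2) (.var 0)).cost + vertexProg.maxCost) * n +
        (Test.natLt (.var 2) (.var 0)).cost + ((Prog.setNat 2 (.const 0)).maxCost +
      (((Test.natLt (.var 2) (.var 1)).cost + edgeProg.maxCost) * m +
        (Test.natLt (.var 2) (.var 1)).cost + (Prog.setNat 2 (.const 0)).maxCost)))) _).mono
      ?_ fun _ h => h
  · refine Runs.seq (Q := VertexInit M vnum enum n) ?_ fun σ h => ?_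
    · refine (Runs.loop (g := 0) (fun i σ => i ≤ n ∧ VertexInit M vnum enum i σ)
        (fun i => ((Test.natLt (.var 2) (.var 0)).cost + vertexProg.maxCost) * (n - i)) ?_
        ⟨Nat.zero_le _, h⟩).mono le_rfl ?_
      · rintro i σ ⟨-, h⟩ hb
        have hi : i < n := by simpa [Test.Holds, NatExp.eval, h.index_eq, h.input.n_eq] using hb
        obtain ⟨v, hv⟩ : ∃ v, (vnum v : ℕ) = i := ⟨vnum.symm ⟨i, hi⟩, by simp⟩
        subst hv
        refine ⟨_, Runs.of_loopFree (by simp [vertexProg, Prog.LoopFree]) ⟨vnum v + 1, ⟨hi, h.step⟩, ?_⟩⟩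
        rw [show n - (vnum v : ℕ) = n - (vnum v + 1) + 1 by omega, mul_add _ _ 1, mul_one]
        omega
      · rintro τ ⟨i, ⟨hi, h⟩, hb⟩
        have : n ≤ i := by simpa [Test.Holds, NatExp.eval, h.index_eq, h.input.n_eq] using hb
        obtain rfl : i = n := by omega
        exact h
    refine Runs.seq (Runs.of_loopFree (Q := EdgeInit M vnum enum 0) (by simp [Prog.LoopFree])
      ⟨hset h.input, by simp [Prog.den, State.setNat, NatExp.eval],
        fun v => h.cur_eq v (vnum v).2, fun v hv => h.lev_eq v (vnum v).2 hv, by simp, by simp,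
        by simp, fun v => ?_⟩) fun σ h => ?_
    · refine (h.ex_eq v (vnum v).2).trans ?_
      simp [Market.excess]
    refine Runs.seq (Q := EdgeInit M vnum enum m) ?_ fun σ h => ?_
    · refine (Runs.loop (g := 0) (fun i σ => i ≤ m ∧ EdgeInit M vnum enum i σ)
        (fun i => ((Test.natLt (.var 2) (.var 1)).cost + edgeProg.maxCost) * (m - i)) ?_
        ⟨Nat.zero_le _, h⟩).mono le_rfl ?_
      · rintro i σ ⟨-, h⟩ hb
        have hi : i < m := by simpa [Test.Holds, NatExp.eval, h.index_eq, h.input.m_eq] using hb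
        obtain ⟨e, he⟩ : ∃ e, (enum e : ℕ) = i := ⟨enum.symm ⟨i, hi⟩, by simp⟩
        subst he
        refine ⟨_, Runs.of_loopFree (by simp [edgeProg, Prog.LoopFree]) ⟨enum e + 1, ⟨hi, h.step⟩, ?_⟩⟩
        rw [show m - (enum e : ℕ) = m - (enum e + 1) + 1 by omega, mul_add _ _ 1, mul_one]
        omega
      · rintro τ ⟨i, ⟨hi, h⟩, hb⟩
        have : m ≤ i := by simpa [Test.Holds, NatExp.eval, h.index_eq, h.input.m_eq] using hb
        obtain rfl : i = m := by omega
        exact h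
    exact Runs.of_loopFree (by simp [Prog.LoopFree])
      ⟨h.rep.congr (by simp [Prog.den, State.setNat]) (by simp [Prog.den, State.setNat]) rfl rfl,
        by simp [Prog.den, State.setNat, NatExp.eval]⟩
  · have h1 : ∀ c, c ≤ c * (n + m + 1) := fun c => Nat.le_mul_of_pos_right c (by omega)
    have h2 : ∀ c, c * n ≤ c * (n + m + 1) := fun c => Nat.mul_le_mul_left c (by omega)
    have h3 : ∀ c, c * m ≤ c * (n + m + 1) := fun c => Nat.mul_le_mul_left c (by omega)
    rw [initCost]
    generalize (Prog.setNat 2 (.const 0)).maxCost = c₁, (Test.natLt (.var 2) (.var 0)).cost = c₂,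
      (Test.natLt (.var 2) (.var 1)).cost = c₃, vertexProg.maxCost = c₄, edgeProg.maxCost = c₅
    have a₁ := h1 c₁
    have a₂ := h1 c₂
    have a₂' := h2 c₂
    have a₃ := h1 c₃
    have a₃' := h3 c₃
    have a₄ := h2 c₄
    have a₅ := h3 c₅
    generalize hN : n + m + 1 = N at *
    simp only [add_mul, mul_assoc]
    omega

end Init
/-! ### Networks -/

namespace IsLinkedList

variable {nil first last : ℕ} {next prev : ℕ → ℕ} {L : List ℕ}

theorem next_of_suffix (h : IsLinkedList nil first last next prev L) {a : ℕ} {l : List ℕ}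
    (hl : a :: l <:+ L) : next a = l.headD nil := by
  obtain ⟨p, rfl⟩ := hl
  have := h.next_eq p.length (by simp)
  simp only [List.getElem_append_right le_rfl, Nat.sub_self, List.getElem_cons_zero] at this
  rw [this]
  cases l <;> simp

theorem prev_of_suffix (h : IsLinkedList nil first last next prev L) {a : ℕ} {l : List ℕ}
    (hl : a :: l <:+ L.reverse) : prev a = l.headD nil := by
  obtain ⟨p, hp⟩ := hl
  obtain rfl : L = l.reverse ++ a :: p.reverse := by
    rw [← List.reverse_reverse L, ← hp]
    simp
  have := h.prev_eq l.reverse.length (by simp)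
  simp only [List.getElem_append_right le_rfl, Nat.sub_self, List.getElem_cons_zero] at this
  rw [this]
  cases l <;> simp

theorem last_eq_headD (h : IsLinkedList nil first last next prev L) :
    last = L.reverse.headD nil := by
  rw [h.last_eq]
  induction L using List.reverseRecOn <;> simp

end IsLinkedList

/-- If `b` stood before `a`, sortedness would give `r b a`, against asymmetry. Thus later in the
preference order means later in the list. -/
theorem mem_of_pairwise {α : Type*} {A : Set α} {r : α → α → Prop}
    (h : IsStrictTotalOrder A fun a b => r a b) {p l : List α} {a b : α}
    (hp : (p ++ a :: l).Pairwise r) (ha : a ∈ A) (hb : b ∈ A) (hmem : b ∈ p ++ a :: l)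
    (hab : r a b) : b ∈ l := by
  have irr : ∀ c ∈ A, ¬ r c c := fun c hc => h.toIsStrictOrder.toIrrefl.irrefl ⟨c, hc⟩
  rcases List.mem_append.1 hmem with h1 | h1
  · have hba : r b a := (List.pairwise_append.1 hp).2.2 b h1 a (by simp)
    exact absurd (h.toIsStrictOrder.toIsTrans.trans ⟨a, ha⟩ ⟨b, hb⟩ ⟨a, ha⟩ hab hba) (irr a ha)
  · rcases List.mem_cons.1 h1 with h2 | h2
    · subst h2
      exact absurd hab (irr _ ha)
    · exact h2

/-! ### From the abstract algorithm to networks -/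

section Bridge

variable {V : Type u} {N : Network V}

open Classical in
/-- The data of the algorithm for a network. -/
noncomputable def toMarket (N : Network V) (β γ : N.Internal → ℝ≥0)
    (outL inL : V → List (Edge N.G)) (hout : ∀ v, Lists (outL v) (edgesOut N.G v))
    (hin : ∀ v, Lists (inL v) (edgesIn N.G v)) : Market V (Edge N.G) where
  tail := Edge.tail
  head := Edge.head
  cap e := N.c e
  internal := N.IsInternal
  low v := if h : N.IsInternal v then β ⟨v, h⟩ else 0
  high v := if h : N.IsInternal v then γ ⟨v, h⟩ else 0
  outL := outL
  inL := inL
  cap_nonneg e := (N.c e).2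
  low_nonneg v := by split_ifs <;> simp
  high_nonneg v := by split_ifs <;> simp
  nodup_outL v := (hout v).1
  nodup_inL v := (hin v).1
  mem_outL v := (hout v).2
  mem_inL v := (hin v).2

variable {β γ : N.Internal → ℝ≥0} {outL inL : V → List (Edge N.G)}
  {hout : ∀ v, Lists (outL v) (edgesOut N.G v)} {hin : ∀ v, Lists (inL v) (edgesIn N.G v)}

theorem excess_toMarket [Fintype (Edge N.G)] (f : Edge N.G → ℝ) (v : V) :
    N.excess f v = (toMarket N β γ outL inL hout hin).excess f v := by
  classical
  simp only [Network.excess, Market.excess, Finset.sum_sub_distrib, finsum_eq_sum_of_fintype,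
    finsum_eq_if]
  rfl

/-- The residual of the first edge of an unsaturated path decides at which end the path is
dominated. -/
theorem isStable_of_inv [Fintype (Edge N.G)] {s : Config V (Edge N.G)}
    (ho : ∀ v, N.IsInternal v → (outL v).Pairwise (N.ltOut v))
    (hi : ∀ v, N.IsInternal v → (inL v).Pairwise (N.ltIn v))
    (hs : (toMarket N β γ outL inL hout hin).Inv s)
    (hb : (toMarket N β γ outL inL hout hin).LowerBound s)
    (ha : ∀ v, ¬ (toMarket N β γ outL inL hout hin).Active s v) :
    N.IsStableQuasiFlow β γ s.flow := by
  set M := toMarket N β γ outL inL hout hin with hM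
  have hex : ∀ v, N.excess s.flow v = M.ex s v := fun v => excess_toMarket _ v
  have hstart : ∀ e, s.flow e < N.c e → s.res (.inl e) ≠ 0 →
      N.StronglyDominatedAtStart s.flow e := by
    intro e he hz
    obtain ⟨h1, h2, h3⟩ := (hs.dominated hb ha he).1 hz
    refine ⟨h1, fun e' he' hlt => ?_, by rw [hex]; exact h2⟩
    obtain ⟨p, l, hpl⟩ := List.append_of_mem ((hout e.tail).2 e |>.2 rfl)
    refine h3 p l hpl e' (mem_of_pairwise (N.ltOut_order _ h1.1 h1.2) (hpl ▸ ho _ h1) rfl he' ?_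
      hlt)
    rw [← hpl]
    exact ((hout e.tail).2 e').2 he'
  have hend : ∀ e, s.flow e < N.c e → s.res (.inl e) = 0 →
      N.StronglyDominatedAtEnd s.flow e ∧ ∀ e' : Edge N.G, e.head = e'.tail →
        s.res (.inl e') = 0 := by
    intro e he hz
    obtain ⟨h1, h2, h3, h4⟩ := (hs.dominated hb ha he).2 hz
    refine ⟨⟨h1, fun e' he' hlt => ?_, by rw [hex]; exact h2⟩, fun e' he' => h4 e' he'.symm⟩
    obtain ⟨p, l, hpl⟩ := List.append_of_mem ((hin e.head).2 e |>.2 rfl)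
    refine h3 p l hpl e' (mem_of_pairwise (N.ltIn_order _ h1.1 h1.2) (hpl ▸ hi _ h1) rfl he' ?_
      hlt)
    rw [← hpl]
    exact ((hin e.head).2 e').2 he'
  refine ⟨⟨fun e => ⟨hs.nonneg _, hs.flow_le e⟩, fun v => ?_⟩, ?_⟩
  · have e1 : M.low v = β v := by simp [hM, toMarket, v.2]
    have e2 : M.high v = γ v := by simp [hM, toMarket, v.2]
    rw [hex, ← e1, ← e2]
    refine ⟨hb.low_le v v.2, ?_⟩
    have h1 : M.ex s v ≤ M.lev s v := not_lt.1 fun h => ha v ⟨v.2, h⟩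
    refine h1.trans ?_
    have := M.low_nonneg v
    have := M.high_nonneg v
    unfold Market.lev
    split <;> linarith
  -- Residual 0 propagates along the path: each head has used up its increases, so the next edge has
  -- residual 0 as well.
  · have key : ∀ (P : List (Edge N.G)) (hP : P ≠ []), N.IsDirectedPath P →
        N.IsUnsaturated s.flow P → s.res (.inl (P.head hP)) = 0 →
        N.StronglyDominatedAtEnd s.flow (P.getLast hP) := by
      intro P
      induction P with
      | nil => intro hP; exact absurd rfl hP
      | cons e P ih =>
        intro hP hd hu hz
        have he := hend e (hu e (by simp)) hz
        cases P with
        | nil => exact he.1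
        | cons e' P =>
          have hd' := List.isChain_cons_cons.1 hd
          rw [List.getLast_cons (List.cons_ne_nil e' P)]
          exact ih (List.cons_ne_nil e' P) hd'.2 (fun a ha => hu a (List.mem_cons_of_mem _ ha))
            (he.2 e' hd'.1)
    intro P hP hd hu
    by_cases hz : s.res (.inl (P.head hP)) = 0
    · exact .inr (key P hP hd hu hz)
    · exact .inl (hstart _ (hu _ (List.head_mem hP)) hz)

theorem input_of_presents {n m : ℕ} {vnum : V ≃ Fin n} {enum : Edge N.G ≃ Fin m} {σ : State}
    (h : Presents N β γ vnum enum σ)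
    (ho : ∀ v, IsLinkedList m (σ.natArr 3 (vnum v)) (σ.natArr 4 (vnum v)) (σ.natArr 5)
      (σ.natArr 6) ((outL v).map fun e => (enum e : ℕ)))
    (hi : ∀ v, IsLinkedList m (σ.natArr 7 (vnum v)) (σ.natArr 8 (vnum v)) (σ.natArr 9)
      (σ.natArr 10) ((inL v).map fun e => (enum e : ℕ))) :
    Input (toMarket N β γ outL inL hout hin) vnum enum σ where
  n_eq := h.vertex_count
  m_eq := h.edge_count
  kind_iff v := by
    refine ⟨fun h0 => ⟨fun hv => ?_, fun hv => ?_⟩, h.kind_internal v⟩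
    · have := h.kind_source v hv; omega
    · have := h.kind_sink v hv; omega
  source_iff e := by
    constructor
    · intro h1 h2
      have := h.kind_internal _ h2
      exact absurd (this.symm.trans h1) (by simp)
    · intro h1
      -- The tail of an edge is not a sink, so if it is not internal, it is a source.
      refine h.kind_source _ ?_
      by_contra hS
      refine h1 ⟨hS, fun hT => ?_⟩
      exact (N.no_edge_from_sink _ hT).subset (rfl : e ∈ edgesOut N.G e.tail)
  tail_eq := h.tail_eq
  head_eq := h.head_eq
  first_out v := (ho v).first_eq
  next_out v e l hl := (ho v).next_of_suffix (hl.map fun e => (enum e : ℕ))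
  last_in v := by
    rw [(hi v).last_eq_headD, ← List.map_reverse]
    rfl
  prev_in v e l hl := (hi v).prev_of_suffix (by
    rw [← List.map_reverse]
    exact hl.map fun e => (enum e : ℕ))
  cap_eq := h.capacity_eq
  low_eq v hv := by
    have hv : N.IsInternal v := hv
    simp [toMarket, hv, h.beta_eq ⟨v, hv⟩]
  high_eq v hv := by
    have hv : N.IsInternal v := hv
    simp [toMarket, hv, h.gamma_eq ⟨v, hv⟩]

/-- The program that finds a stable quasi-flow. -/
def stableProg : Prog :=
  .ite (.natEq (.var 1) (.const 0)) .skip (.seq initProg searchProg)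

/-- The constant in the bound on the running time. -/
def stableCost : ℕ :=
  (Test.natEq (.var 1) (.const 0)).cost + Prog.skip.maxCost + 3 * initCost + 27 * roundCost

theorem runs_stableProg {n m : ℕ} {vnum : V ≃ Fin n} {enum : Edge N.G ≃ Fin m} {σ : State}
    (h : Presents N β γ vnum enum σ) :
    Runs stableProg σ (stableCost * (n * m + 1)) fun τ =>
      N.IsStableQuasiFlow β γ (output enum τ) := by
  classical
  have : Fintype V := Fintype.ofEquiv _ vnum.symm
  have : Fintype (Edge N.G) := Fintype.ofEquiv _ enum.symm
  have hm : Fintype.card (Edge N.G) = m := by rw [Fintype.card_congr enum, Fintype.card_fin]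
  choose outL hout ho hol using h.out_list
  choose inL hin hi hil using h.in_list
  set M := toMarket N β γ outL inL hout hin
  have hinput : Input M vnum enum σ := input_of_presents h hol hil
  -- For `m = 0` the bound is a constant, which leaves no time to scan the vertices; but without
  -- edges every memory holds a stable quasi-flow.
  rcases Nat.eq_zero_or_pos m with h0 | hpos
  · subst h0
    have hE : IsEmpty (Edge N.G) := enum.isEmpty
    refine (Runs.ite (T := Prog.skip.maxCost) (fun _ => Runs.of_loopFree (by simp [Prog.LoopFree])
      (Q := fun τ => N.IsStableQuasiFlow β γ (output enum τ)) ?_)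
      (fun hb => absurd (by simp [Test.Holds, NatExp.eval, h.edge_count]) hb)).mono ?_
      fun _ h => h
    · refine ⟨⟨fun e => isEmptyElim e, fun v => ?_⟩, fun P hP => ?_⟩
      · rw [excess_toMarket (β := β) (γ := γ) (hout := hout) (hin := hin)]
        simp [Market.excess]
      · exact isEmptyElim (P.head hP)
    · rw [mul_zero, zero_add, mul_one, stableCost]
      omega
  · refine (Runs.ite (T := initCost * (n + m + 1) + roundCost * (n + 2) * (8 * m + 1))
      (fun hb => absurd (by simpa [Test.Holds, NatExp.eval, h.edge_count] using hb) hpos.ne')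
      (fun _ => Runs.seq (runs_init hinput) fun τ hτ => (runs_search_loop (inv_initial M)
        (lowerBound_initial M) hτ.1 hτ.2).mono ?_ fun ρ hρ => ?_)).mono ?_ fun _ h => h
    · have e1 := Market.events_le (M := M) (initial M)
      have e2 := (inv_initial M).card_activeSet_le
      rw [hm] at e1 e2
      -- The initial potential is at most `2 * 3m + 2m = 8m`.
      exact Nat.mul_le_mul_left _ (by omega)
    · obtain ⟨s, h1, h2, h3, h4⟩ := hρ
      have : output enum ρ = s.flow := funext fun e => h1.res_eq (.inr e)
      rw [this]
      exact isStable_of_inv ho hi h2 h3 h4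
    · have hn : 0 < n := by
        have e : Edge N.G := enum.symm ⟨0, hpos⟩
        exact (vnum e.tail).pos
      have a1 : n ≤ n * m := Nat.le_mul_of_pos_right n hpos
      have a2 : m ≤ n * m := Nat.le_mul_of_pos_left m hn
      have b1 : initCost * (n + m + 1) ≤ initCost * (3 * (n * m + 1)) :=
        Nat.mul_le_mul_left _ (by omega)
      -- Since `n` and `m` are positive, `n + 2 ≤ 3n` and `8m + 1 ≤ 9m`; hence the 27.
      have b2 : (n + 2) * (8 * m + 1) ≤ 27 * (n * m + 1) := by nlinarith
      have b3 := Nat.mul_le_mul_left roundCost b2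
      have b4 : (Test.natEq (.var 1) (.const 0)).cost ≤
          (Test.natEq (.var 1) (.const 0)).cost * (n * m + 1) :=
        Nat.le_mul_of_pos_right _ (by omega)
      have b5 : stableCost * (n * m + 1) = (Test.natEq (.var 1) (.const 0)).cost * (n * m + 1) +
          Prog.skip.maxCost * (n * m + 1) + initCost * (3 * (n * m + 1)) +
          roundCost * (27 * (n * m + 1)) := by
        rw [stableCost]; ring
      rw [← mul_assoc roundCost] at b3
      omega

end Bridge

/-! ### Every network can be presented -/

theorem exists_sorted_list {α : Type*} [Finite α] (A : Set α) (r : α → α → Prop)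
    (h : IsStrictTotalOrder A fun a b => r a b) :
    ∃ L : List α, (L.Nodup ∧ ∀ a, a ∈ L ↔ a ∈ A) ∧ L.Pairwise r := by
  classical
  let := linearOrderOfSTO (fun a b : A => r a b)
  have := Fintype.ofFinite A
  refine ⟨(Finset.univ.sort (α := A)).map Subtype.val,
    ⟨(Finset.sort_nodup _ _).map Subtype.val_injective, fun a => by simp⟩, ?_⟩
  exact List.pairwise_map.2 (Finset.sortedLT_sort _).pairwise

theorem isLinkedList_of_nodup {nil : ℕ} {next prev : ℕ → ℕ} {L : List ℕ} (hL : L.Nodup)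
    (hnext : ∀ a ∈ L, next a = L.getD (L.idxOf a + 1) nil)
    (hprev : ∀ a ∈ L, prev a = (nil :: L).getD (L.idxOf a) nil) :
    IsLinkedList nil (L.headD nil) (L.getLastD nil) next prev L where
  nodup := hL
  first_eq := rfl
  last_eq := rfl
  next_eq i h := by rw [hnext _ (List.getElem_mem h), hL.idxOf_getElem]
  prev_eq i h := by rw [hprev _ (List.getElem_mem h), hL.idxOf_getElem]

/-- Every edge lies in exactly one list of leaving edges and one list of entering edges, so the
lists of all vertices can share the successor and predecessor arrays. -/
theorem exists_presents {V : Type u} [Finite V] (N : Network V) (β γ : N.Internal → ℝ≥0) :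
    ∃ (n m : ℕ) (vnum : V ≃ Fin n) (enum : Edge N.G ≃ Fin m) (σ : State),
      Presents N β γ vnum enum σ := by
  classical
  have hlist : ∀ (A : Set (Edge N.G)) (r : Edge N.G → Edge N.G → Prop) (I : Prop),
      (I → IsStrictTotalOrder A fun e e' => r e e') →
      ∃ L : List (Edge N.G), Lists L A ∧ (I → L.Pairwise r) := by
    intro A r I h
    by_cases hI : I
    · obtain ⟨L, h1, h2⟩ := exists_sorted_list A r (h hI)
      exact ⟨L, h1, fun _ => h2⟩
    · have := Fintype.ofFinite A
      exact ⟨A.toFinset.toList, ⟨Finset.nodup_toList _, by simp⟩, fun h => absurd h hI⟩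
  choose outL hout ho using fun v => hlist (edgesOut N.G v) (N.ltOut v) (N.IsInternal v)
    fun h => N.ltOut_order v h.1 h.2
  choose inL hin hi using fun v => hlist (edgesIn N.G v) (N.ltIn v) (N.IsInternal v)
    fun h => N.ltIn_order v h.1 h.2
  have vnum := Finite.equivFin V
  have enum := Finite.equivFin (Edge N.G)
  set n := Nat.card V
  set m := Nat.card (Edge N.G)
  have hv : Function.Injective fun v => (vnum v : ℕ) := Fin.val_injective.comp vnum.injective
  have he : Function.Injective fun e => (enum e : ℕ) := Fin.val_injective.comp enum.injective
  set out := fun v => (outL v).map fun e => (enum e : ℕ)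
  set inn := fun v => (inL v).map fun e => (enum e : ℕ)
  let onV {X : Type} (g : V → X) (d : X) : ℕ → X :=
    Function.extend (fun v => (vnum v : ℕ)) g fun _ => d
  let onE {X : Type} (g : Edge N.G → X) (d : X) : ℕ → X :=
    Function.extend (fun e => (enum e : ℕ)) g fun _ => d
  have onV_eq : ∀ {X : Type} (g : V → X) (d : X) v, onV g d (vnum v) = g v :=
    fun g d v => hv.extend_apply g _ v
  have onE_eq : ∀ {X : Type} (g : Edge N.G → X) (d : X) e, onE g d (enum e) = g e :=
    fun g d e => he.extend_apply g _ e
  refine ⟨n, m, vnum, enum,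
    { natVar := fun k => if k = 0 then n else m
      realVar := fun _ => 0
      natArr := fun k => match k with
        | 0 => onV (fun v => if v ∈ N.S then 1 else if v ∈ N.T then 2 else 0) 0
        | 1 => onE (fun e => vnum e.tail) 0
        | 2 => onE (fun e => vnum e.head) 0
        | 3 => onV (fun v => (out v).headD m) 0
        | 4 => onV (fun v => (out v).getLastD m) 0
        | 5 => onE (fun e => (out e.tail).getD ((out e.tail).idxOf (enum e : ℕ) + 1) m) 0
        | 6 => onE (fun e => (m :: out e.tail).getD ((out e.tail).idxOf (enum e : ℕ)) m) 0
        | 7 => onV (fun v => (inn v).headD m) 0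
        | 8 => onV (fun v => (inn v).getLastD m) 0
        | 9 => onE (fun e => (inn e.head).getD ((inn e.head).idxOf (enum e : ℕ) + 1) m) 0
        | 10 => onE (fun e => (m :: inn e.head).getD ((inn e.head).idxOf (enum e : ℕ)) m) 0
        | _ => fun _ => 0
      realArr := fun k => match k with
        | 0 => onE (fun e => N.c e) 0
        | 1 => onV (fun v => if h : N.IsInternal v then β ⟨v, h⟩ else 0) 0
        | 2 => onV (fun v => if h : N.IsInternal v then γ ⟨v, h⟩ else 0) 0
        | _ => fun _ => 0 }, ?_⟩
  refine ⟨rfl, rfl, fun v h => ?_, fun v h => ?_, fun v h => ?_,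
    onE_eq (fun e => (vnum e.tail : ℕ)) 0, onE_eq (fun e => (vnum e.head : ℕ)) 0,
    fun v => ⟨outL v, hout v, ho v, ?_⟩, fun v => ⟨inL v, hin v, hi v, ?_⟩,
    onE_eq (fun e => (N.c e : ℝ)) 0, fun v => ?_, fun v => ?_⟩
  · simp only [onV_eq]
    simp [h.1, h.2]
  · simp only [onV_eq]
    simp [h]
  · have : v ∉ N.S := fun h' => Set.disjoint_left.1 N.disjoint_S_T h' h
    simp only [onV_eq]
    simp [h, this]
  · simp only [onV_eq]
    refine isLinkedList_of_nodup ((hout v).1.map he) ?_ ?_ <;>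
    · intro a ha
      obtain ⟨e, hmem, rfl⟩ := List.mem_map.1 ha
      obtain rfl : e.tail = v := ((hout v).2 e).1 hmem
      exact onE_eq _ _ e
  · simp only [onV_eq]
    refine isLinkedList_of_nodup ((hin v).1.map he) ?_ ?_ <;>
    · intro a ha
      obtain ⟨e, hmem, rfl⟩ := List.mem_map.1 ha
      obtain rfl : e.head = v := ((hin v).2 e).1 hmem
      exact onE_eq _ _ e
  · simp only [onV_eq]
    simp [v.2]
  · simp only [onV_eq]
    simp [v.2]

end StableFlow

theorem mainTheorem4 :
    (∀ (V : Type u) [Finite V] (N : StableFlow.Network V) (β γ : N.Internal → ℝ≥0),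
      ∃ f : StableFlow.Edge N.G → ℝ, N.IsStableQuasiFlow β γ f) ∧
    ∃ (P : StableFlow.Prog) (C : ℕ),
      ∀ (V : Type u) (N : StableFlow.Network V) (β γ : N.Internal → ℝ≥0) (n m : ℕ)
        (vnum : V ≃ Fin n) (enum : StableFlow.Edge N.G ≃ Fin m) (σ : StableFlow.State),
        StableFlow.Presents N β γ vnum enum σ →
        ∃ (t : ℕ) (τ : StableFlow.State),
          StableFlow.Exec P σ t τ ∧ t ≤ C * (n * m + 1) ∧
          N.IsStableQuasiFlow β γ (StableFlow.output enum τ) := by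
  refine ⟨fun V _ N β γ => ?_, StableFlow.stableProg, StableFlow.stableCost,
    fun V N β γ n m vnum enum σ h => StableFlow.runs_stableProg h⟩
  -- Existence is read off from the output of the program on some presentation of the network.
  obtain ⟨n, m, vnum, enum, σ, h⟩ := StableFlow.exists_presents N β γ
  obtain ⟨t, τ, -, -, hτ⟩ := StableFlow.runs_stableProg h
  exact ⟨_, hτ⟩
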